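/- Let $L>0$, let $a,b,c,\lambda>0$ be constants, and let $p\in L^1[0,L]$ be nonnegative with $p\not\equiv 0$ (that is, $p$ is not a.e. zero). Consider the Melan problem $$w''''(x)-\Big(a+b\int_0^L w\,dt\Big)w''(x)+c\int_0^L w\,dt=p(x)\ \text{ for a.e. }x\in(0,L),\qquad w(0)=w(L)=w''(0)=w''(L)=0, \tag{1}$$ whose solutions are sought in $W^{4,1}[0,L]$. Put $$\sigma(z)=\frac{3z^3}{6z\cosh z+6z-12\sinh z-z^3}\quad(z>0),\qquad M=a+\frac{2b\lambda L}{\pi},\qquad N=c+\frac{b\lambda\pi^2}{L^2},\qquad \beta(x)=\lambda\sin\frac{\pi x}{L},$$ and let $[0,\beta]=\{u\in C^2[0,L]: 0\le u\le\beta,\ 0\ge u''\ge\beta''\text{ on }[0,L]\}$. Assume that $$p(x)\le\Big[\lambda\frac{\pi^4}{L^4}+a\lambda\frac{\pi^2}{L^2}+2b\lambda^2\frac{\pi}{L}\Big]\sin\frac{\pi x}{L}+2\lambda c\frac{L}{\pi}\ \text{ for a.e. }x\in(0,L),\qquad N\le\frac{4M}{L^3}\,\sigma(\sqrt M\,L),$$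 and $$\lambda\frac{L^3}{4}\Big[\frac{2b}{\pi}+\frac{b\pi^2}{4}\Big]\le 1 .$$ Then (1) has exactly one solution $y$ in $[0,\beta]$, and $y>0$ on $(0,L)$. Moreover, for every initial function $u_0\in[0,\beta]$ (in particular for $u_0\equiv 0$ and for $u_0=\beta$) the iteration $$u_n''''-Mu_n''+N\int_0^L u_n\,dt=p+b\,u_{n-1}''\int_0^L u_{n-1}\,dt-\frac{2b\lambda L}{\pi}u_{n-1}''+\frac{b\lambda\pi^2}{L^2}\int_0^L u_{n-1}\,dt\ \text{ a.e. in }(0,L),$$ $$u_n(0)=u_n(L)=u_n''(0)=u_n''(L)=0,\qquad n=1,2,\dots,$$ determines a unique sequence $u_n\in W^{4,1}[0,L]$ $(n\ge1)$, and $u_n\to y$ uniformly on $[0,L]$. -/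

import Mathlib

open Set Filter Topology MeasureTheory

noncomputable section

namespace Melan

/-- The `k`-th derivative of `u` on `[0, L]` (one-sided at the end points). -/
def D (L : ℝ) (k : ℕ) (u : ℝ → ℝ) : ℝ → ℝ :=
  iteratedDerivWithin k u (Icc 0 L)

/-- `u ∈ W^{4,1}[0, L]`, in its usual one-dimensional description: `u` (its continuous
representative) is `C³` on `[0, L]` and its third derivative is absolutely continuous there;
the fourth derivative then exists almost everywhere and is integrable. -/
structure MemW41 (L : ℝ) (u : ℝ → ℝ) : Prop where
  contDiffOn : ContDiffOn ℝ 3 u (Icc 0 L)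
  absCont : AbsolutelyContinuousOnInterval (D L 3 u) 0 L

/-- The hinged (Navier) boundary conditions `u(0) = u(L) = u''(0) = u''(L) = 0`. -/
def NavierBC (L : ℝ) (u : ℝ → ℝ) : Prop :=
  u 0 = 0 ∧ u L = 0 ∧ D L 2 u 0 = 0 ∧ D L 2 u L = 0

/-- `w ∈ W^{4,1}[0, L]` solves the Melan problem
`w'''' - (a + b ∫ w) w'' + c ∫ w = p` a.e. in `(0, L)`, with Navier boundary conditions. -/
structure IsSolution (L a b c : ℝ) (p w : ℝ → ℝ) : Prop where
  mem : MemW41 L w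
  bc : NavierBC L w
  eqn : ∀ᵐ x ∂(volume.restrict (Ioo 0 L)),
    D L 4 w x - (a + b * ∫ t in (0 : ℝ)..L, w t) * D L 2 w x + c * (∫ t in (0 : ℝ)..L, w t) = p x

/-- The function `σ(z) = 3 z³ / (6 z cosh z + 6 z - 12 sinh z - z³)`. -/
def sigma (z : ℝ) : ℝ :=
  3 * z ^ 3 / (6 * z * Real.cosh z + 6 * z - 12 * Real.sinh z - z ^ 3)

/-- The sector `[α, β] = {u ∈ C²[0, L] : α ≤ u ≤ β, α'' ≥ u'' ≥ β''}`. -/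
def Sector (L : ℝ) (α β : ℝ → ℝ) : Set (ℝ → ℝ) :=
  {u | ContDiffOn ℝ 2 u (Icc 0 L) ∧ ∀ x ∈ Icc 0 L,
    (α x ≤ u x ∧ u x ≤ β x) ∧ (D L 2 u x ≤ D L 2 α x ∧ D L 2 β x ≤ D L 2 u x)}

/-- The function `λ sin(π x / L)`. -/
def sineArc (L lam : ℝ) : ℝ → ℝ := fun x => lam * Real.sin (Real.pi / L * x)

/-- `v` is obtained from `u` by one step of the iteration: `v ∈ W^{4,1}[0, L]` satisfies
`v'''' - (a + 2bλL/π) v'' + (c + bλπ²/L²) ∫ v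
  = p + b u'' ∫ u - (2bλL/π) u'' + (bλπ²/L²) ∫ u` a.e. in `(0, L)`,
with Navier boundary conditions. -/
structure IsStep (L a b c lam : ℝ) (p u v : ℝ → ℝ) : Prop where
  mem : MemW41 L v
  bc : NavierBC L v
  eqn : ∀ᵐ x ∂(volume.restrict (Ioo 0 L)),
    D L 4 v x - (a + 2 * b * lam * (L / Real.pi)) * D L 2 v x
        + (c + b * lam * (Real.pi ^ 2 / L ^ 2)) * (∫ t in (0 : ℝ)..L, v t)
      = p x + b * D L 2 u x * (∫ t in (0 : ℝ)..L, u t)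
        - 2 * b * lam * (L / Real.pi) * D L 2 u x
        + b * lam * (Real.pi ^ 2 / L ^ 2) * (∫ t in (0 : ℝ)..L, u t)

/-- The sequence `u` is produced by the iteration with initial function `u₀`. -/
structure IsIteration (L a b c lam : ℝ) (p u₀ : ℝ → ℝ) (u : ℕ → ℝ → ℝ) : Prop where
  init : u 0 = u₀
  step : ∀ n, IsStep L a b c lam p (u n) (u (n + 1))

/-- The iteration with initial function `u₀` is well defined (it produces exactly one sequence
of functions on `[0, L]`) and converges to `y` uniformly on `[0, L]`. -/
structure IterationConverges (L a b c lam : ℝ) (p u₀ y : ℝ → ℝ) : Prop where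
  exists_seq : ∃ u, IsIteration L a b c lam p u₀ u
  unique_seq : ∀ u v, IsIteration L a b c lam p u₀ u → IsIteration L a b c lam p u₀ v →
    ∀ n, EqOn (u n) (v n) (Icc 0 L)
  tendsto : ∀ u, IsIteration L a b c lam p u₀ u → TendstoUniformlyOn u y atTop (Icc 0 L)

end Melan

end

/-! The Melan equation is rewritten as a fixed-point problem for a monotone map. Adding the same
linear terms to both sides gives the constant-coefficient operator `u'''' - M u'' + N ∫ u` on the
left. The constants `M` and `N` are large enough that the right-hand side is increasing on the
sector for the order `u ≤ v`, `u'' ≥ v''` (`rhs_mono`).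

The operator on the left preserves this order. With `m = √M`, let `G` be the Green function of `-y''
+ m² y` under Dirichlet conditions, `g` the solution with right-hand side `1`, and `ψ` the solution
with right-hand side `x (L - x) / 2`. Then `-u''` is the integral of the operator's value against
the rank-one perturbation `G(x, s) - N g(x) ψ(s) / (1 + N ∫ ψ)`. The product `g(x) ψ(s)` is bounded
by a multiple of `G(x, s)` (`gFun_mul_psiFun_le`). The assumption on `N` makes that multiple small
enough for the kernel to be nonnegative (`key_inequality`, `kernelFun_nonneg`).

Since `p ≥ 0`, the zero function is a lower solution, and the upper bound on `p` says that `β` is an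
upper solution. The step map therefore preserves the sector. Second derivatives of the iterates from
`0` and from `β` are monotone in `n`, and their limits are second derivatives of solutions `y` and
`z` (`exists_limit_solution`), with `y` below every solution in the sector.

Two ordered solutions coincide: if `y ≤ z` and `y'' ≥ z''`, the original equation gives `y'''' ≥
z''''`, and the maximum principle applied to the second derivatives gives `y'' ≤ z''`
(`below_symm_of_isSolution`). This yields uniqueness, and every other iteration is squeezed between
the two extreme ones. -/

noncomputable section

namespace Melan

/-! ### Twice differentiable functions in the Carathéodory sense -/

/-- `y` and `y₁` are absolutely continuous on `[0, L]`, and `y' = y₁`, `y₁' = y₂` almost everywhere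
in `(0, L)`. -/
structure HasSecondDeriv (L : ℝ) (y y₁ y₂ : ℝ → ℝ) : Prop where
  absCont : AbsolutelyContinuousOnInterval y 0 L
  absCont_deriv : AbsolutelyContinuousOnInterval y₁ 0 L
  hasDerivAt : ∀ᵐ x ∂(volume.restrict (Ioo 0 L)), HasDerivAt y (y₁ x) x
  hasDerivAt_deriv : ∀ᵐ x ∂(volume.restrict (Ioo 0 L)), HasDerivAt y₁ (y₂ x) x

theorem integral_congr_ae_Ioo {L α β : ℝ} {f g : ℝ → ℝ} (hα : 0 ≤ α) (hαβ : α ≤ β) (hβ : β ≤ L)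
    (h : ∀ᵐ x ∂(volume.restrict (Ioo 0 L)), f x = g x) :
    ∫ x in α..β, f x = ∫ x in α..β, g x := by
  rw [intervalIntegral.integral_of_le hαβ, intervalIntegral.integral_of_le hαβ,
    integral_Ioc_eq_integral_Ioo, integral_Ioc_eq_integral_Ioo]
  exact integral_congr_ae (ae_mono (Measure.restrict_mono (Ioo_subset_Ioo hα hβ) le_rfl) h)

theorem intervalIntegrable_congr_ae_Ioo {L : ℝ} {f g : ℝ → ℝ} (hL : 0 < L)
    (hf : IntervalIntegrable f volume 0 L)
    (h : ∀ᵐ x ∂(volume.restrict (Ioo 0 L)), f x = g x) : IntervalIntegrable g volume 0 L := by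
  rw [intervalIntegrable_iff_integrableOn_Ioo_of_le hL.le] at *
  exact hf.congr h

/-- A nonnegative continuous kernel preserves almost everywhere inequalities. -/
theorem integral_kernel_mono {L : ℝ} {k f g : ℝ → ℝ} (hL : 0 < L) (hk : Continuous k)
    (hk0 : ∀ s ∈ Icc 0 L, 0 ≤ k s) (hf : IntervalIntegrable f volume 0 L)
    (hg : IntervalIntegrable g volume 0 L)
    (h : ∀ᵐ x ∂(volume.restrict (Ioo 0 L)), f x ≤ g x) :
    ∫ s in (0 : ℝ)..L, k s * f s ≤ ∫ s in (0 : ℝ)..L, k s * g s := by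
  have hf' := hf.continuousOn_mul hk.continuousOn
  have hg' := hg.continuousOn_mul hk.continuousOn
  rw [intervalIntegrable_iff_integrableOn_Ioo_of_le hL.le] at hf' hg'
  rw [intervalIntegral.integral_of_le hL.le, intervalIntegral.integral_of_le hL.le,
    integral_Ioc_eq_integral_Ioo, integral_Ioc_eq_integral_Ioo]
  refine integral_mono_ae hf' hg' ?_
  filter_upwards [h, ae_restrict_mem measurableSet_Ioo] with x hx hmem
  exact mul_le_mul_of_nonneg_left hx (hk0 x ⟨hmem.1.le, hmem.2.le⟩)

theorem HasSecondDeriv.of_hasDerivAt {L : ℝ} {q q₁ q₂ : ℝ → ℝ}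
    (h₀ : ∀ x, HasDerivAt q (q₁ x) x) (h₁ : ∀ x, HasDerivAt q₁ (q₂ x) x) (h₂ : Continuous q₂) :
    HasSecondDeriv L q q₁ q₂ := by
  have c₁ : Continuous q₁ := continuous_iff_continuousAt.2 fun x => (h₁ x).continuousAt
  have aux : ∀ {f f' : ℝ → ℝ}, (∀ x, HasDerivAt f (f' x) x) → Continuous f' →
      AbsolutelyContinuousOnInterval f 0 L := fun {f f'} h hc => by
    refine ContDiffOn.absolutelyContinuousOnInterval (ContDiff.contDiffOn ?_)
    have e : deriv f = f' := funext fun x => (h x).deriv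
    exact contDiff_one_iff_deriv.2 ⟨fun x => (h x).differentiableAt, e ▸ hc⟩
  exact ⟨aux h₀ c₁, aux h₁ h₂, Eventually.of_forall h₀, Eventually.of_forall h₁⟩

namespace HasSecondDeriv

variable {L : ℝ} {y y₁ y₂ q q₁ q₂ : ℝ → ℝ}

theorem continuousOn (hL : 0 < L) (hy : HasSecondDeriv L y y₁ y₂) : ContinuousOn y (Icc 0 L) := by
  simpa [uIcc_of_le hL.le] using hy.absCont.continuousOn

theorem intervalIntegrable (hL : 0 < L) (hy : HasSecondDeriv L y y₁ y₂) :
    IntervalIntegrable y volume 0 L :=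
  ContinuousOn.intervalIntegrable_of_Icc hL.le (hy.continuousOn hL)

theorem intervalIntegrable_deriv₂ (hL : 0 < L) (hy : HasSecondDeriv L y y₁ y₂) :
    IntervalIntegrable y₂ volume 0 L := by
  refine intervalIntegrable_congr_ae_Ioo hL hy.absCont_deriv.intervalIntegrable_deriv ?_
  filter_upwards [hy.hasDerivAt_deriv] with x hx using hx.deriv

/-- Lagrange's identity. -/
theorem integral_lagrange (hy : HasSecondDeriv L y y₁ y₂) (hq : HasSecondDeriv L q q₁ q₂)
    {α β : ℝ} (hα : 0 ≤ α) (hαβ : α ≤ β) (hβ : β ≤ L) :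
    ∫ x in α..β, (y x * q₂ x - y₂ x * q x)
      = (y β * q₁ β - y₁ β * q β) - (y α * q₁ α - y₁ α * q α) := by
  have hac : AbsolutelyContinuousOnInterval (fun x => y x * q₁ x - y₁ x * q x) α β :=
    ((hy.absCont.fun_mul hq.absCont_deriv).fun_sub (hy.absCont_deriv.fun_mul hq.absCont)).mono
      (by rw [uIcc_of_le hαβ, uIcc_of_le (hα.trans (hαβ.trans hβ))]; exact Icc_subset_Icc hα hβ)
  rw [← hac.integral_deriv_eq_sub]
  refine integral_congr_ae_Ioo hα hαβ hβ ?_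
  filter_upwards [hy.hasDerivAt, hy.hasDerivAt_deriv, hq.hasDerivAt, hq.hasDerivAt_deriv]
    with x h1 h2 h3 h4
  rw [((h1.fun_mul h4).fun_sub (h2.fun_mul h3)).deriv]
  ring

/-- Green's representation of a function vanishing at both end points, in terms of solutions `q`,
`r` of `q'' = M q` vanishing at `0` and at `L` respectively. -/
theorem green_representation (hL : 0 < L) {M w : ℝ} {r r₁ : ℝ → ℝ}
    (hy : HasSecondDeriv L y y₁ y₂) (hy0 : y 0 = 0) (hyL : y L = 0)
    (hq : HasSecondDeriv L q q₁ (fun x => M * q x)) (hr : HasSecondDeriv L r r₁ (fun x => M * r x))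
    (hq0 : q 0 = 0) (hrL : r L = 0) (hqc : Continuous q) (hrc : Continuous r)
    (hw : w ≠ 0) (hwr : ∀ x, q₁ x * r x - q x * r₁ x = w) {x : ℝ} (hx : x ∈ Icc 0 L) :
    y x = ∫ s in (0 : ℝ)..L, (q (min x s) * r (max x s) / w) * (M * y s - y₂ s) := by
  have hi : IntervalIntegrable (fun s => (q (min x s) * r (max x s) / w) * (M * y s - y₂ s))
      volume 0 L :=
    (((hy.intervalIntegrable hL).const_mul M).sub
      (hy.intervalIntegrable_deriv₂ hL)).continuousOn_mul (by fun_prop)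
  have hsub₁ : uIcc 0 x ⊆ uIcc 0 L := by
    rw [uIcc_of_le hx.1, uIcc_of_le hL.le]; exact Icc_subset_Icc_right hx.2
  have hsub₂ : uIcc x L ⊆ uIcc 0 L := by
    rw [uIcc_of_le hx.2, uIcc_of_le hL.le]; exact Icc_subset_Icc_left hx.1
  -- The kernel is smooth on each side of `s = x`, so Lagrange's identity applies on `[0, x]` with
  -- `q` and on `[x, L]` with `r`. The boundary terms at `x` combine into the Wronskian `w`.
  rw [← intervalIntegral.integral_add_adjacent_intervals (hi.mono_set hsub₁) (hi.mono_set hsub₂)]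
  have e₁ : ∫ s in (0 : ℝ)..x, (q (min x s) * r (max x s) / w) * (M * y s - y₂ s)
      = r x / w * ∫ s in (0 : ℝ)..x, (y s * (M * q s) - y₂ s * q s) := by
    rw [← intervalIntegral.integral_const_mul]
    refine intervalIntegral.integral_congr fun s hs => ?_
    rw [uIcc_of_le hx.1] at hs
    simp only [min_eq_right hs.2, max_eq_left hs.2]
    ring
  have e₂ : ∫ s in x..L, (q (min x s) * r (max x s) / w) * (M * y s - y₂ s)
      = q x / w * ∫ s in x..L, (y s * (M * r s) - y₂ s * r s) := by
    rw [← intervalIntegral.integral_const_mul]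
    refine intervalIntegral.integral_congr fun s hs => ?_
    rw [uIcc_of_le hx.2] at hs
    simp only [min_eq_left hs.1, max_eq_right hs.1]
    ring
  rw [e₁, e₂, hy.integral_lagrange hq le_rfl hx.1 hx.2, hy.integral_lagrange hr hx.1 hx.2 le_rfl,
    hy0, hyL, hq0, hrL]
  field_simp
  rw [← hwr x]
  ring

/-- The kernel of `-y''` with Dirichlet conditions. -/
theorem eq_integral_dirichlet (hL : 0 < L) (hy : HasSecondDeriv L y y₁ y₂) (hy0 : y 0 = 0)
    (hyL : y L = 0) {x : ℝ} (hx : x ∈ Icc 0 L) :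
    y x = ∫ s in (0 : ℝ)..L, (min x s * (L - max x s) / L) * (-y₂ s) := by
  have hq : HasSecondDeriv L (fun x : ℝ => x) (fun _ => 1) (fun x => 0 * x) :=
    .of_hasDerivAt (fun x => hasDerivAt_id x) (fun x => by simpa using hasDerivAt_const x (1 : ℝ))
      (by fun_prop)
  have hr : HasSecondDeriv L (fun x : ℝ => L - x) (fun _ => -1) (fun x => 0 * (L - x)) :=
    .of_hasDerivAt (fun x => by simpa using (hasDerivAt_id x).const_sub L)
      (fun x => by simpa using hasDerivAt_const x (-1 : ℝ)) (by fun_prop)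
  simpa using hy.green_representation hL hy0 hyL hq hr rfl (by simp) (by fun_prop) (by fun_prop)
    hL.ne' (fun x => by ring) hx

end HasSecondDeriv

theorem dirichlet_kernel_nonneg {L x s : ℝ} (hx : x ∈ Icc 0 L) (hs : s ∈ Icc 0 L) :
    0 ≤ min x s * (L - max x s) / L := by
  have : max x s ≤ L := max_le hx.2 hs.2
  exact div_nonneg (mul_nonneg (le_min hx.1 hs.1) (by linarith)) (hx.1.trans hx.2)

/-- A crude bound, enough to turn an `L¹` estimate of second derivatives into a uniform estimate of
the functions. -/
theorem dirichlet_kernel_le {L x s : ℝ} (hL : 0 < L) (hx : x ∈ Icc 0 L) (hs : s ∈ Icc 0 L) :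
    min x s * (L - max x s) / L ≤ L := by
  rw [div_le_iff₀ hL]
  have h1 : max x s ≤ L := max_le hx.2 hs.2
  have h2 : 0 ≤ max x s := hx.1.trans (le_max_left _ _)
  exact mul_le_mul ((min_le_left _ _).trans hx.2) (by linarith) (by linarith) hL.le

namespace HasSecondDeriv

variable {L : ℝ} {y y₁ y₂ z z₁ z₂ : ℝ → ℝ}

/-- Comparison principle for `-y''` with Dirichlet conditions. -/
theorem le_of_deriv₂_ge (hL : 0 < L) (hy : HasSecondDeriv L y y₁ y₂) (hz : HasSecondDeriv L z z₁ z₂)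
    (hy0 : y 0 = 0) (hyL : y L = 0) (hz0 : z 0 = 0) (hzL : z L = 0)
    (h : ∀ᵐ x ∂(volume.restrict (Ioo 0 L)), z₂ x ≤ y₂ x) {x : ℝ} (hx : x ∈ Icc 0 L) :
    y x ≤ z x := by
  rw [hy.eq_integral_dirichlet hL hy0 hyL hx, hz.eq_integral_dirichlet hL hz0 hzL hx]
  refine integral_kernel_mono hL (by fun_prop) (fun s hs => dirichlet_kernel_nonneg hx hs)
    (hy.intervalIntegrable_deriv₂ hL).neg (hz.intervalIntegrable_deriv₂ hL).neg ?_
  filter_upwards [h] with x hx using neg_le_neg hx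

end HasSecondDeriv

end Melan

namespace Melan

/-! ### Derivatives on `[0, L]` -/

theorem D_zero (L : ℝ) (u : ℝ → ℝ) : D L 0 u = u := iteratedDerivWithin_zero

theorem D_succ (L : ℝ) (k : ℕ) (u : ℝ → ℝ) : D L (k + 1) u = derivWithin (D L k u) (Icc 0 L) :=
  iteratedDerivWithin_succ

theorem D_congr {L : ℝ} {u v : ℝ → ℝ} (h : EqOn u v (Icc 0 L)) (k : ℕ) :
    EqOn (D L k u) (D L k v) (Icc 0 L) := iteratedDerivWithin_congr h

theorem contDiffOn_D {L : ℝ} (hL : 0 < L) {u : ℝ → ℝ} {n : ℕ} :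
    ∀ {k m : ℕ}, ContDiffOn ℝ n u (Icc 0 L) → m + k ≤ n → ContDiffOn ℝ m (D L k u) (Icc 0 L)
  | 0, m, hu, h => by
    rw [D_zero]
    exact hu.of_le (by exact_mod_cast h)
  | k + 1, m, hu, h => by
    rw [D_succ]
    have := contDiffOn_D hL (k := k) (m := m + 1) hu (by omega)
    exact this.derivWithin (uniqueDiffOn_Icc hL) (by norm_cast)

theorem hasDerivAt_D_of_differentiableAt {L : ℝ} {u : ℝ → ℝ} {k : ℕ} {x : ℝ} (hx : x ∈ Ioo 0 L)
    (h : DifferentiableAt ℝ (D L k u) x) : HasDerivAt (D L k u) (D L (k + 1) u x) x := by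
  rw [D_succ, derivWithin_of_mem_nhds (Icc_mem_nhds hx.1 hx.2)]
  exact h.hasDerivAt

theorem hasDerivAt_D {L : ℝ} (hL : 0 < L) {u : ℝ → ℝ} {n k : ℕ} (hu : ContDiffOn ℝ n u (Icc 0 L))
    (hk : k < n) {x : ℝ} (hx : x ∈ Ioo 0 L) : HasDerivAt (D L k u) (D L (k + 1) u x) x :=
  hasDerivAt_D_of_differentiableAt hx
    (((contDiffOn_D hL (m := 1) hu (by omega)).differentiableOn one_ne_zero).differentiableAt
      (Icc_mem_nhds hx.1 hx.2))

/-- The derivatives `D L k u` of a function with globally defined derivatives. -/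
theorem D_succ_eqOn {L : ℝ} (hL : 0 < L) {u f f' : ℝ → ℝ} {k : ℕ}
    (h : EqOn (D L k u) f (Icc 0 L)) (hf : ∀ x, HasDerivAt f (f' x) x) :
    EqOn (D L (k + 1) u) f' (Icc 0 L) := fun x hx => by
  rw [D_succ, derivWithin_congr h (h hx)]
  exact (hf x).hasDerivWithinAt.derivWithin (uniqueDiffOn_Icc hL x hx)

theorem absolutelyContinuousOnInterval_D {L : ℝ} (hL : 0 < L) {u : ℝ → ℝ} {n k : ℕ}
    (hu : ContDiffOn ℝ n u (Icc 0 L)) (hk : k < n) :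
    AbsolutelyContinuousOnInterval (D L k u) 0 L := by
  refine ContDiffOn.absolutelyContinuousOnInterval ?_
  rw [uIcc_of_le hL.le]
  exact contDiffOn_D hL (m := 1) hu (by omega)

theorem continuousOn_D {L : ℝ} (hL : 0 < L) {u : ℝ → ℝ} {n k : ℕ}
    (hu : ContDiffOn ℝ n u (Icc 0 L)) (hk : k ≤ n) : ContinuousOn (D L k u) (Icc 0 L) :=
  (contDiffOn_D hL (m := 0) hu (by omega)).continuousOn

theorem hasSecondDeriv_of_contDiffOn {L : ℝ} (hL : 0 < L) {u : ℝ → ℝ}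
    (hu : ContDiffOn ℝ 2 u (Icc 0 L)) : HasSecondDeriv L u (D L 1 u) (D L 2 u) := by
  have hu' : ContDiffOn ℝ (2 : ℕ) u (Icc 0 L) := by exact_mod_cast hu
  refine ⟨?_, absolutelyContinuousOnInterval_D hL hu' (by norm_num), ?_, ?_⟩
  · simpa [D_zero] using absolutelyContinuousOnInterval_D hL hu' (k := 0) (by norm_num)
  · filter_upwards [ae_restrict_mem measurableSet_Ioo] with x hx
    simpa [D_zero] using hasDerivAt_D hL hu' (k := 0) (by norm_num) hx
  · filter_upwards [ae_restrict_mem measurableSet_Ioo] with x hx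
    exact hasDerivAt_D hL hu' (k := 1) (by norm_num) hx

namespace MemW41

variable {L : ℝ} {u : ℝ → ℝ}

theorem contDiffOn_two (hu : MemW41 L u) : ContDiffOn ℝ 2 u (Icc 0 L) :=
  hu.contDiffOn.of_le (by norm_num)

theorem hasSecondDeriv_D (hL : 0 < L) (hu : MemW41 L u) :
    HasSecondDeriv L (D L 2 u) (D L 3 u) (D L 4 u) := by
  have hu' : ContDiffOn ℝ (3 : ℕ) u (Icc 0 L) := by exact_mod_cast hu.contDiffOn
  refine ⟨absolutelyContinuousOnInterval_D hL hu' (by norm_num), hu.absCont, ?_, ?_⟩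
  · filter_upwards [ae_restrict_mem measurableSet_Ioo] with x hx
    exact hasDerivAt_D hL hu' (by norm_num) hx
  · filter_upwards [ae_restrict_mem measurableSet_Ioo,
      ae_restrict_of_ae hu.absCont.ae_differentiableAt] with x hx h
    refine hasDerivAt_D_of_differentiableAt hx (h ?_)
    rw [uIcc_of_le hL.le]
    exact ⟨hx.1.le, hx.2.le⟩

end MemW41

/-- Assembling a function of class `W^{4,1}` from its derivatives. -/
theorem memW41_of_hasDerivAt {L : ℝ} (hL : 0 < L) {u u₁ u₂ u₃ u₄ : ℝ → ℝ}
    (h₀ : ∀ x, HasDerivAt u (u₁ x) x) (h₁ : ∀ x, HasDerivAt u₁ (u₂ x) x)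
    (h₂ : ∀ x, HasDerivAt u₂ (u₃ x) x) (h₃ : Continuous u₃)
    (hac : AbsolutelyContinuousOnInterval u₃ 0 L)
    (h₄ : ∀ᵐ x ∂(volume.restrict (Ioo 0 L)), HasDerivAt u₃ (u₄ x) x) :
    MemW41 L u ∧ EqOn (D L 2 u) u₂ (Icc 0 L) ∧
      ∀ᵐ x ∂(volume.restrict (Ioo 0 L)), D L 4 u x = u₄ x := by
  have e₀ : EqOn (D L 0 u) u (Icc 0 L) := by rw [D_zero]; exact fun _ _ => rfl
  have e₁ := D_succ_eqOn hL e₀ h₀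
  have e₂ := D_succ_eqOn hL e₁ h₁
  have e₃ := D_succ_eqOn hL e₂ h₂
  have cd : ∀ {n : ℕ} {f f' : ℝ → ℝ}, (∀ x, HasDerivAt f (f' x) x) → ContDiff ℝ n f' →
      ContDiff ℝ (n + 1 : ℕ) f := fun {n f f'} h hc => by
    have e : deriv f = f' := funext fun x => (h x).deriv
    have := contDiff_succ_iff_deriv (n := n) (f := f)
    push_cast
    exact this.2 ⟨fun x => (h x).differentiableAt, by simp, e ▸ hc⟩
  have c₃ : ContDiff ℝ (0 : ℕ) u₃ := by exact_mod_cast contDiff_zero.2 h₃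
  refine ⟨⟨by exact_mod_cast (cd h₀ (cd h₁ (cd h₂ c₃))).contDiffOn, ?_⟩, e₂, ?_⟩
  -- `D L 3 u` and `u₃` agree only on `[0, L]`, but absolute continuity there involves no other
  -- values.
  · rw [absolutelyContinuousOnInterval_iff] at hac ⊢
    intro ε hε
    obtain ⟨δ, hδ, H⟩ := hac ε hε
    refine ⟨δ, hδ, fun E hE hlt => ?_⟩
    refine lt_of_eq_of_lt (Finset.sum_congr rfl fun i hi => ?_) (H E hE hlt)
    have := hE.1 i hi
    rw [uIcc_of_le hL.le] at this
    rw [e₃ this.1, e₃ this.2]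
  · filter_upwards [h₄, ae_restrict_mem measurableSet_Ioo] with x hx hmem
    have hev : D L 3 u =ᶠ[𝓝 x] u₃ :=
      Filter.eventuallyEq_of_mem (Icc_mem_nhds hmem.1 hmem.2) e₃
    have hd := hx.congr_of_eventuallyEq hev
    exact (hasDerivAt_D_of_differentiableAt hmem hd.differentiableAt).unique hd

end Melan

namespace Melan

/-! ### The linear problem `u'''' - m² u'' = h` -/

theorem hasDerivAt_sinh_mul (m x : ℝ) :
    HasDerivAt (fun x => Real.sinh (m * x)) (m * Real.cosh (m * x)) x := by
  simpa [mul_comm] using ((hasDerivAt_id x).const_mul m).sinh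

theorem hasDerivAt_cosh_mul (m x : ℝ) :
    HasDerivAt (fun x => Real.cosh (m * x)) (m * Real.sinh (m * x)) x := by
  simpa [mul_comm] using ((hasDerivAt_id x).const_mul m).cosh

/-- Variation of constants: `z'' = m² (z - P)` with `z(0) = 0` and `z(L) = A`. -/
theorem exists_dirichlet_solution {L m : ℝ} (hL : 0 < L) (hm : 0 < m) {P : ℝ → ℝ}
    (hP : Continuous P) (A : ℝ) :
    ∃ z z₁ : ℝ → ℝ, (∀ x, HasDerivAt z (z₁ x) x) ∧
      (∀ x, HasDerivAt z₁ (m ^ 2 * (z x - P x)) x) ∧ z 0 = 0 ∧ z L = A := by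
  set c : ℝ → ℝ := fun x => ∫ s in (0 : ℝ)..x, Real.cosh (m * s) * P s with hc
  set d : ℝ → ℝ := fun x => ∫ s in (0 : ℝ)..x, Real.sinh (m * s) * P s with hd
  have hc' : ∀ x, HasDerivAt c (Real.cosh (m * x) * P x) x := fun x =>
    (Continuous.integral_hasStrictDerivAt (by fun_prop) 0 x).hasDerivAt
  have hd' : ∀ x, HasDerivAt d (Real.sinh (m * x) * P x) x := fun x =>
    (Continuous.integral_hasStrictDerivAt (by fun_prop) 0 x).hasDerivAt
  have hS : 0 < Real.sinh (m * L) := Real.sinh_pos_iff.2 (mul_pos hm hL)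
  obtain ⟨C, hC⟩ : ∃ C, -m * (Real.sinh (m * L) * c L - Real.cosh (m * L) * d L)
      + C * Real.sinh (m * L) = A :=
    ⟨(A + m * (Real.sinh (m * L) * c L - Real.cosh (m * L) * d L)) / Real.sinh (m * L), by
      field_simp; ring⟩
  -- Variation of constants with `c` and `d` as the two primitives. The multiple `C` of the
  -- homogeneous solution `sinh (m x)` adjusts the value at `L`.
  refine ⟨fun x => -m * (Real.sinh (m * x) * c x - Real.cosh (m * x) * d x)
    + C * Real.sinh (m * x), fun x => -m ^ 2 * (Real.cosh (m * x) * c x - Real.sinh (m * x) * d x)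
    + C * (m * Real.cosh (m * x)), fun x => ?_, fun x => ?_, by simp [hc, hd], hC⟩
  · have := (((((hasDerivAt_sinh_mul m x).fun_mul (hc' x)).fun_sub
      ((hasDerivAt_cosh_mul m x).fun_mul (hd' x))).const_mul (-m)).fun_add
      ((hasDerivAt_sinh_mul m x).const_mul C))
    refine this.congr_deriv ?_
    ring
  · have := (((((hasDerivAt_cosh_mul m x).fun_mul (hc' x)).fun_sub
      ((hasDerivAt_sinh_mul m x).fun_mul (hd' x))).const_mul (-m ^ 2)).fun_add
      (((hasDerivAt_cosh_mul m x).const_mul m).const_mul C))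
    refine this.congr_deriv ?_
    linear_combination (-m ^ 2 * P x) * Real.cosh_sq_sub_sinh_sq (m * x)

/-- Let `P` be the second primitive of `h` and let `z'' = m² (z - P)`, `z(0) = 0`, `z(L) = P(L)`.
Then `u'' = P - z` satisfies the equation and vanishes at both ends. Because `P - z = -z'' / m²`,
the function `u` itself is `-z / m²` plus a linear term, so no further integration is needed. The
irregularity of `h` enters only through `P`. -/
theorem exists_linear_solution {L m : ℝ} (hL : 0 < L) (hm : 0 < m) {h : ℝ → ℝ}
    (hh : IntervalIntegrable h volume 0 L) :
    ∃ u, MemW41 L u ∧ NavierBC L u ∧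
      ∀ᵐ x ∂(volume.restrict (Ioo 0 L)), D L 4 u x - m ^ 2 * D L 2 u x = h x := by
  set k : ℝ → ℝ := (Ioo 0 L).indicator h with hk
  have hki : Integrable k volume := by
    rw [hk, integrable_indicator_iff measurableSet_Ioo]
    exact (intervalIntegrable_iff_integrableOn_Ioo_of_le hL.le).1 hh
  set H : ℝ → ℝ := fun x => ∫ s in (0 : ℝ)..x, k s with hH
  have hHc : Continuous H :=
    intervalIntegral.continuous_primitive (fun _ _ => hki.intervalIntegrable) 0
  have hH' : ∀ᵐ x ∂(volume.restrict (Ioo 0 L)), HasDerivAt H (h x) x := by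
    filter_upwards [ae_restrict_of_ae
        (LocallyIntegrable.ae_hasDerivAt_integral hki.locallyIntegrable),
      ae_restrict_mem measurableSet_Ioo] with x hx hmem
    simpa [hk, hmem] using hx 0
  have hHac : AbsolutelyContinuousOnInterval H 0 L :=
    hki.intervalIntegrable.absolutelyContinuousOnInterval_intervalIntegral (by simp)
  set P : ℝ → ℝ := fun x => ∫ s in (0 : ℝ)..x, H s with hP
  have hP' : ∀ x, HasDerivAt P (H x) x := fun x =>
    (Continuous.integral_hasStrictDerivAt hHc 0 x).hasDerivAt
  have hPc : Continuous P := continuous_iff_continuousAt.2 fun x => (hP' x).continuousAt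
  obtain ⟨z, z₁, hz, hz₁, hz0, hzL⟩ := exists_dirichlet_solution hL hm hPc (P L)
  have hzc : Continuous z := continuous_iff_continuousAt.2 fun x => (hz x).continuousAt
  have hz₁c : Continuous z₁ := continuous_iff_continuousAt.2 fun x => (hz₁ x).continuousAt
  have hZ : HasSecondDeriv L z z₁ (fun x => m ^ 2 * (z x - P x)) :=
    .of_hasDerivAt hz hz₁ (by fun_prop)
  obtain ⟨hmem, e₂, e₄⟩ := memW41_of_hasDerivAt hL (u := fun x => (x * (P L / L) - z x) / m ^ 2)
    (u₁ := fun x => (P L / L - z₁ x) / m ^ 2) (u₂ := fun x => P x - z x)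
    (u₃ := fun x => H x - z₁ x) (u₄ := fun x => h x - m ^ 2 * (z x - P x))
    (fun x => by
      simpa using (((hasDerivAt_id x).mul_const (P L / L)).fun_sub (hz x)).div_const (m ^ 2))
    (fun x => by
      refine (((hz₁ x).const_sub (P L / L)).div_const (m ^ 2)).congr_deriv ?_
      field_simp
      ring)
    (fun x => (hP' x).fun_sub (hz x)) (by fun_prop)
    (hHac.fun_sub hZ.absCont_deriv)
    (by filter_upwards [hH'] with x hx using hx.fun_sub (hz₁ x))
  refine ⟨_, hmem, ⟨by simp [hz0], ?_, ?_, ?_⟩, ?_⟩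
  · simp only [hzL]
    field_simp
    ring
  · rw [e₂ ⟨le_rfl, hL.le⟩]
    simp [hz0, hP]
  · rw [e₂ ⟨hL.le, le_rfl⟩]
    simp [hzL]
  · filter_upwards [e₄, ae_restrict_mem measurableSet_Ioo] with x hx hmem
    rw [hx, e₂ ⟨hmem.1.le, hmem.2.le⟩]
    ring

end Melan

namespace Melan

/-! ### Hyperbolic inequalities -/

theorem sinh_lt_mul_cosh {y : ℝ} (hy : 0 < y) : Real.sinh y < y * Real.cosh y := by
  have hd : ∀ x : ℝ, HasDerivAt (fun x => x * Real.cosh x - Real.sinh x) (x * Real.sinh x) x :=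
    fun x => (((hasDerivAt_id x).fun_mul (Real.hasDerivAt_cosh x)).fun_sub
      (Real.hasDerivAt_sinh x)).congr_deriv (by simp)
  have hmono : StrictMonoOn (fun x => x * Real.cosh x - Real.sinh x) (Ici 0) := by
    refine strictMonoOn_of_deriv_pos (convex_Ici 0) (by fun_prop) fun x hx => ?_
    rw [interior_Ici] at hx
    rw [(hd x).deriv]
    exact mul_pos hx (Real.sinh_pos_iff.2 hx)
  have := hmono (mem_Ici.2 le_rfl) (mem_Ici.2 hy.le) hy
  simp at this
  linarith

/-- Half-angle form of `sinh y < y cosh y`. It gives `tanh (m L / 2) < m L / 2`, hence the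
positivity of the slope of `ψ` at `0`. -/
theorem cosh_sub_one_lt {y : ℝ} (hy : 0 < y) : Real.cosh y - 1 < y / 2 * Real.sinh y := by
  have h := sinh_lt_mul_cosh (half_pos hy)
  have hs : 0 < Real.sinh (y / 2) := Real.sinh_pos_iff.2 (half_pos hy)
  have e₁ : Real.cosh y = Real.cosh (y / 2) ^ 2 + Real.sinh (y / 2) ^ 2 := by
    rw [← Real.cosh_two_mul]; ring_nf
  have e₂ : Real.sinh y = 2 * Real.sinh (y / 2) * Real.cosh (y / 2) := by
    rw [← Real.sinh_two_mul]; ring_nf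
  rw [e₁, e₂, Real.cosh_sq]
  nlinarith [mul_lt_mul_of_pos_left h hs]

theorem cosh_sub_one_le {y : ℝ} (hy : 0 ≤ y) : Real.cosh y - 1 ≤ y / 2 * Real.sinh y := by
  rcases hy.eq_or_lt with rfl | hy
  · simp
  · exact (cosh_sub_one_lt hy).le

theorem sinh_add_le {x y : ℝ} (hx : 0 ≤ x) (hy : 0 ≤ y) :
    Real.sinh x + Real.sinh y ≤ Real.sinh (x + y) := by
  rw [Real.sinh_add]
  nlinarith [Real.one_le_cosh x, Real.one_le_cosh y, Real.sinh_nonneg_iff.2 hx,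
    Real.sinh_nonneg_iff.2 hy]

/-! ### The auxiliary boundary value problems -/

/-- `tanh (m L / 2)`. -/
def tanhHalf (L m : ℝ) : ℝ := (Real.cosh (m * L) - 1) / Real.sinh (m * L)

/-- The solution of `-g'' + m² g = 1`, `g(0) = g(L) = 0`. -/
def gFun (L m : ℝ) (x : ℝ) : ℝ :=
  (1 - Real.cosh (m * x) + tanhHalf L m * Real.sinh (m * x)) / m ^ 2

/-- The derivative of `gFun`. -/
def gDeriv (L m : ℝ) (x : ℝ) : ℝ :=
  (-Real.sinh (m * x) + tanhHalf L m * Real.cosh (m * x)) / m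

/-- The solution of `-ψ'' + m² ψ = x (L - x) / 2`, `ψ(0) = ψ(L) = 0`. -/
def psiFun (L m : ℝ) (x : ℝ) : ℝ := (x * (L - x) / 2 - gFun L m x) / m ^ 2

/-- The derivative of `psiFun`. -/
def psiDeriv (L m : ℝ) (x : ℝ) : ℝ := (L / 2 - x - gDeriv L m x) / m ^ 2

/-- The Green function of `-y'' + m² y` with Dirichlet conditions on `[0, L]`. -/
def greenFun (L m : ℝ) (x s : ℝ) : ℝ :=
  Real.sinh (m * min x s) * Real.sinh (m * (L - max x s)) / (m * Real.sinh (m * L))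

variable {L m : ℝ}

theorem continuous_greenFun (L m x : ℝ) : Continuous (greenFun L m x) := by
  unfold greenFun; fun_prop

theorem continuous_psiFun (L m : ℝ) : Continuous (psiFun L m) := by
  unfold psiFun gFun; fun_prop

theorem hasDerivAt_gFun (hm : 0 < m) (x : ℝ) : HasDerivAt (gFun L m) (gDeriv L m x) x := by
  refine ((((hasDerivAt_cosh_mul m x).const_sub 1).fun_add
    ((hasDerivAt_sinh_mul m x).const_mul (tanhHalf L m))).div_const (m ^ 2)).congr_deriv ?_
  unfold gDeriv
  field_simp

theorem hasDerivAt_gDeriv (hm : 0 < m) (x : ℝ) :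
    HasDerivAt (gDeriv L m) (m ^ 2 * gFun L m x - 1) x := by
  refine (((hasDerivAt_sinh_mul m x).fun_neg.fun_add
    ((hasDerivAt_cosh_mul m x).const_mul (tanhHalf L m))).div_const m).congr_deriv ?_
  unfold gFun
  field_simp
  ring

theorem hasDerivAt_arch (x : ℝ) : HasDerivAt (fun x => x * (L - x) / 2) (L / 2 - x) x := by
  refine (((hasDerivAt_id x).fun_mul ((hasDerivAt_id x).const_sub L)).div_const 2).congr_deriv ?_
  simp only [id]
  ring

theorem hasDerivAt_psiFun (hm : 0 < m) (x : ℝ) : HasDerivAt (psiFun L m) (psiDeriv L m x) x :=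
  ((hasDerivAt_arch x).fun_sub (hasDerivAt_gFun hm x)).div_const (m ^ 2)

theorem hasDerivAt_psiDeriv (hm : 0 < m) (x : ℝ) :
    HasDerivAt (psiDeriv L m) (m ^ 2 * psiFun L m x - x * (L - x) / 2) x := by
  refine ((((hasDerivAt_id x).const_sub (L / 2)).fun_sub
    (hasDerivAt_gDeriv hm x)).div_const (m ^ 2)).congr_deriv ?_
  unfold psiFun
  field_simp
  ring

theorem continuous_gFun (L m : ℝ) : Continuous (gFun L m) := by
  unfold gFun; fun_prop

theorem hasSecondDeriv_gFun (hm : 0 < m) :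
    HasSecondDeriv L (gFun L m) (gDeriv L m) (fun x => m ^ 2 * gFun L m x - 1) :=
  .of_hasDerivAt (hasDerivAt_gFun hm) (hasDerivAt_gDeriv hm)
    (by have := continuous_gFun L m; fun_prop)

theorem hasSecondDeriv_psiFun (hm : 0 < m) :
    HasSecondDeriv L (psiFun L m) (psiDeriv L m)
      (fun x => m ^ 2 * psiFun L m x - x * (L - x) / 2) :=
  .of_hasDerivAt (hasDerivAt_psiFun hm) (hasDerivAt_psiDeriv hm)
    (by have := continuous_psiFun L m; fun_prop)

theorem hasSecondDeriv_arch :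
    HasSecondDeriv L (fun x => x * (L - x) / 2) (fun x => L / 2 - x) (fun _ => -1) :=
  .of_hasDerivAt hasDerivAt_arch (fun x => (hasDerivAt_id x).const_sub (L / 2)) (by fun_prop)

theorem sinh_mul_pos (hL : 0 < L) (hm : 0 < m) : 0 < Real.sinh (m * L) :=
  Real.sinh_pos_iff.2 (mul_pos hm hL)

theorem tanhHalf_mul_sinh (hL : 0 < L) (hm : 0 < m) :
    tanhHalf L m * Real.sinh (m * L) = Real.cosh (m * L) - 1 :=
  div_mul_cancel₀ _ (sinh_mul_pos hL hm).ne'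

theorem tanhHalf_mul_cosh_add_one (hL : 0 < L) (hm : 0 < m) :
    tanhHalf L m * (Real.cosh (m * L) + 1) = Real.sinh (m * L) := by
  unfold tanhHalf
  rw [div_mul_eq_mul_div, div_eq_iff (sinh_mul_pos hL hm).ne']
  linear_combination Real.cosh_sq (m * L)

theorem tanhHalf_pos (hL : 0 < L) (hm : 0 < m) : 0 < tanhHalf L m :=
  div_pos (sub_pos.2 (Real.one_lt_cosh.2 (mul_pos hm hL).ne')) (sinh_mul_pos hL hm)

theorem tanhHalf_lt (hL : 0 < L) (hm : 0 < m) : tanhHalf L m < m * L / 2 := by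
  unfold tanhHalf
  rw [div_lt_iff₀ (sinh_mul_pos hL hm)]
  exact cosh_sub_one_lt (mul_pos hm hL)

theorem gFun_zero : gFun L m 0 = 0 := by simp [gFun]

theorem gFun_sub (hL : 0 < L) (hm : 0 < m) (x : ℝ) : gFun L m (L - x) = gFun L m x := by
  unfold gFun
  congr 1
  rw [mul_sub, Real.cosh_sub, Real.sinh_sub]
  linear_combination Real.cosh (m * x) * tanhHalf_mul_sinh hL hm
    - Real.sinh (m * x) * tanhHalf_mul_cosh_add_one hL hm

theorem psiFun_sub (hL : 0 < L) (hm : 0 < m) (x : ℝ) : psiFun L m (L - x) = psiFun L m x := by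
  unfold psiFun
  rw [gFun_sub hL hm]
  ring

theorem psiFun_zero : psiFun L m 0 = 0 := by simp [psiFun, gFun_zero]

theorem gFun_right (hL : 0 < L) (hm : 0 < m) : gFun L m L = 0 := by
  rw [← gFun_sub hL hm, sub_self, gFun_zero]

theorem psiFun_right (hL : 0 < L) (hm : 0 < m) : psiFun L m L = 0 := by
  rw [← psiFun_sub hL hm, sub_self, psiFun_zero]

/-- After multiplication by `m² sinh (m L)` this is the superadditivity of `sinh` at `m x` and `m (L
- x)`. -/
theorem gFun_nonneg (hL : 0 < L) (hm : 0 < m) {x : ℝ} (hx : x ∈ Icc 0 L) : 0 ≤ gFun L m x := by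
  refine div_nonneg (nonneg_of_mul_nonneg_left ?_ (sinh_mul_pos hL hm)) (by positivity)
  have h := sinh_add_le (mul_nonneg hm.le hx.1) (mul_nonneg hm.le (sub_nonneg.2 hx.2))
  have e : m * x + m * (L - x) = m * L := by ring
  rw [e, mul_sub, Real.sinh_sub] at h
  have e' : (1 - Real.cosh (m * x) + tanhHalf L m * Real.sinh (m * x)) * Real.sinh (m * L)
      = (1 - Real.cosh (m * x)) * Real.sinh (m * L)
        + Real.sinh (m * x) * (Real.cosh (m * L) - 1) := by
    linear_combination Real.sinh (m * x) * tanhHalf_mul_sinh hL hm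
  linarith

theorem gDeriv_zero : gDeriv L m 0 = tanhHalf L m / m := by simp [gDeriv]

theorem psiDeriv_zero : psiDeriv L m 0 = (L / 2 - tanhHalf L m / m) / m ^ 2 := by
  simp [psiDeriv, gDeriv_zero]

theorem gDeriv_zero_pos (hL : 0 < L) (hm : 0 < m) : 0 < gDeriv L m 0 := by
  rw [gDeriv_zero]; exact div_pos (tanhHalf_pos hL hm) hm

theorem psiDeriv_zero_pos (hL : 0 < L) (hm : 0 < m) : 0 < psiDeriv L m 0 := by
  rw [psiDeriv_zero]
  refine div_pos (sub_pos.2 ?_) (by positivity)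
  rw [div_lt_iff₀ hm]
  linarith [tanhHalf_lt hL hm]

/-- The majorant is a factor of the Green function, scaled to have the same slope at `0` as the
left-hand side. The gap is `(cosh (m x) - 1) / m`. -/
theorem gFun_le (hm : 0 < m) (x : ℝ) : m * gFun L m x ≤ gDeriv L m 0 * Real.sinh (m * x) := by
  have e : gDeriv L m 0 * Real.sinh (m * x) - m * gFun L m x = (Real.cosh (m * x) - 1) / m := by
    rw [gDeriv_zero, gFun]
    field_simp
    ring
  have : 0 ≤ (Real.cosh (m * x) - 1) / m :=
    div_nonneg (sub_nonneg.2 (Real.one_le_cosh _)) hm.le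
  linarith

/-- The same tangency at `0` as for `gFun_le`. The gap splits into two terms, nonnegative by `sinh t
≥ t` and by `cosh t - 1 ≤ (t / 2) sinh t`. -/
theorem psiFun_le (hm : 0 < m) {x : ℝ} (hx : x ∈ Icc 0 L) :
    m * psiFun L m x ≤ psiDeriv L m 0 * Real.sinh (m * x) := by
  have e : psiDeriv L m 0 * Real.sinh (m * x) - m * psiFun L m x
      = (m * (L - x) / 2 * (Real.sinh (m * x) - m * x)
        + (m * x / 2 * Real.sinh (m * x) - (Real.cosh (m * x) - 1))) / m ^ 3 := by
    rw [psiDeriv_zero, psiFun, gFun]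
    field_simp
    ring
  have hmx : 0 ≤ m * x := mul_nonneg hm.le hx.1
  have h₁ := cosh_sub_one_le hmx
  have h₂ := Real.self_le_sinh_iff.2 hmx
  have h₃ : 0 ≤ m * (L - x) / 2 * (Real.sinh (m * x) - m * x) :=
    mul_nonneg (div_nonneg (mul_nonneg hm.le (sub_nonneg.2 hx.2)) two_pos.le) (sub_nonneg.2 h₂)
  have : 0 ≤ (m * (L - x) / 2 * (Real.sinh (m * x) - m * x)
        + (m * x / 2 * Real.sinh (m * x) - (Real.cosh (m * x) - 1))) / m ^ 3 :=
    div_nonneg (by linarith) (by positivity)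
  linarith

theorem gFun_le' (hL : 0 < L) (hm : 0 < m) (x : ℝ) :
    m * gFun L m x ≤ gDeriv L m 0 * Real.sinh (m * (L - x)) := by
  rw [← gFun_sub hL hm]; exact gFun_le hm _

theorem psiFun_le' (hL : 0 < L) (hm : 0 < m) {x : ℝ} (hx : x ∈ Icc 0 L) :
    m * psiFun L m x ≤ psiDeriv L m 0 * Real.sinh (m * (L - x)) := by
  rw [← psiFun_sub hL hm]
  exact psiFun_le hm ⟨sub_nonneg.2 hx.2, by linarith [hx.1]⟩

/-- Whichever of `x`, `s` is nearer to `0` is estimated by the majorant vanishing at `0`, the other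
by the reflected majorant vanishing at `L`. The product of the two majorants is the numerator of the
Green function. -/
theorem gFun_mul_psiFun_le (hL : 0 < L) (hm : 0 < m) {x s : ℝ} (hx : x ∈ Icc 0 L)
    (hs : s ∈ Icc 0 L) : m ^ 2 * (gFun L m x * psiFun L m s)
      ≤ gDeriv L m 0 * psiDeriv L m 0
        * (Real.sinh (m * min x s) * Real.sinh (m * (L - max x s))) := by
  have hg := gFun_nonneg hL hm hx
  rcases le_total x s with h | h
  · rw [min_eq_left h, max_eq_right h]
    have h₁ := gFun_le (L := L) hm x
    have h₂ := psiFun_le' hL hm hs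
    have h₃ : 0 ≤ psiDeriv L m 0 * Real.sinh (m * (L - s)) :=
      mul_nonneg (psiDeriv_zero_pos hL hm).le
        (Real.sinh_nonneg_iff.2 (mul_nonneg hm.le (sub_nonneg.2 hs.2)))
    calc _ = m * gFun L m x * (m * psiFun L m s) := by ring
      _ ≤ m * gFun L m x * (psiDeriv L m 0 * Real.sinh (m * (L - s))) :=
        mul_le_mul_of_nonneg_left h₂ (mul_nonneg hm.le hg)
      _ ≤ gDeriv L m 0 * Real.sinh (m * x) * (psiDeriv L m 0 * Real.sinh (m * (L - s))) :=
        mul_le_mul_of_nonneg_right h₁ h₃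
      _ = _ := by ring
  · rw [min_eq_right h, max_eq_left h]
    have h₁ := gFun_le' hL hm x
    have h₂ := psiFun_le hm hs
    have h₃ : 0 ≤ psiDeriv L m 0 * Real.sinh (m * s) :=
      mul_nonneg (psiDeriv_zero_pos hL hm).le
        (Real.sinh_nonneg_iff.2 (mul_nonneg hm.le hs.1))
    calc _ = m * gFun L m x * (m * psiFun L m s) := by ring
      _ ≤ m * gFun L m x * (psiDeriv L m 0 * Real.sinh (m * s)) :=
        mul_le_mul_of_nonneg_left h₂ (mul_nonneg hm.le hg)
      _ ≤ gDeriv L m 0 * Real.sinh (m * (L - x)) * (psiDeriv L m 0 * Real.sinh (m * s)) :=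
        mul_le_mul_of_nonneg_right h₁ h₃
      _ = _ := by ring

/-- The integral of `psiFun` over `[0, L]`. -/
def psiInt (L m : ℝ) : ℝ := ∫ s in (0 : ℝ)..L, psiFun L m s

theorem psiInt_eq (hL : 0 < L) (hm : 0 < m) :
    psiInt L m = (L ^ 3 / 12 - (L - 2 * tanhHalf L m / m) / m ^ 2) / m ^ 2 := by
  have hd : ∀ x, HasDerivAt (fun x => (L * x ^ 2 / 4 - x ^ 3 / 6
      - (x - Real.sinh (m * x) / m + tanhHalf L m * Real.cosh (m * x) / m) / m ^ 2) / m ^ 2)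
      (psiFun L m x) x := fun x => by
    refine (((((hasDerivAt_pow 2 x).const_mul L).div_const 4).fun_sub
      ((hasDerivAt_pow 3 x).div_const 6)).fun_sub
      ((((hasDerivAt_id x).fun_sub ((hasDerivAt_sinh_mul m x).div_const m)).fun_add
        (((hasDerivAt_cosh_mul m x).const_mul (tanhHalf L m)).div_const m)).div_const
          (m ^ 2))).div_const (m ^ 2) |>.congr_deriv ?_
    unfold psiFun gFun
    field_simp
    push_cast
    ring
  rw [psiInt, intervalIntegral.integral_eq_sub_of_hasDerivAt (fun x _ => hd x)
    ((continuous_psiFun L m).intervalIntegrable _ _)]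
  simp only [mul_zero, Real.sinh_zero, Real.cosh_zero]
  field_simp
  have h := tanhHalf_mul_cosh_add_one hL hm
  rw [mul_comm m L] at h
  linear_combination (-288) * h

end Melan

namespace Melan

variable {L m N : ℝ}

/-! ### The kernel of `u'''' - m² u'' + N ∫ u` -/

/-- This is the assumption on `N` in disguise. With `Q` the denominator of `σ(m L)`, the assumption
reads `N Q ≤ 12 m ^ 5`, and the right side minus the left side equals `(12 m ^ 5 - N Q) / (12 m ^
4)`. -/
theorem key_inequality (hL : 0 < L) (hm : 0 < m) (hN : 0 < N)
    (hkey : N ≤ 4 * m ^ 2 / L ^ 3 * sigma (m * L)) :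
    N * Real.sinh (m * L) * (gDeriv L m 0 * psiDeriv L m 0) ≤ m * (1 + N * psiInt L m) := by
  set Q := 6 * (m * L) * Real.cosh (m * L) + 6 * (m * L) - 12 * Real.sinh (m * L) - (m * L) ^ 3
    with hQ
  have hσ : sigma (m * L) = 3 * (m * L) ^ 3 / Q := rfl
  have hz : 0 < m * L := mul_pos hm hL
  -- If `Q ≤ 0`, then `σ(m L) ≤ 0` (the value at `Q = 0` is `0` by convention), which contradicts `0
  -- < N`.
  have hQpos : 0 < Q := by
    by_contra hneg
    have : sigma (m * L) ≤ 0 := by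
      rw [hσ]; exact div_nonpos_of_nonneg_of_nonpos (by positivity) (not_lt.1 hneg)
    have : 4 * m ^ 2 / L ^ 3 * sigma (m * L) ≤ 0 :=
      mul_nonpos_of_nonneg_of_nonpos (by positivity) this
    linarith
  have h₁ : N * Q ≤ 12 * m ^ 5 := by
    have e : 4 * m ^ 2 / L ^ 3 * sigma (m * L) = 12 * m ^ 5 / Q := by
      rw [hσ]; field_simp; ring
    rwa [e, le_div_iff₀ hQpos] at hkey
  have e : m * (1 + N * psiInt L m) - N * Real.sinh (m * L) * (gDeriv L m 0 * psiDeriv L m 0)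
      = (12 * m ^ 5 - N * Q) / (12 * m ^ 4) := by
    rw [psiInt_eq hL hm, gDeriv_zero, psiDeriv_zero, hQ]
    have h₂ := tanhHalf_mul_sinh hL hm
    have h₃ := tanhHalf_mul_cosh_add_one hL hm
    generalize Real.sinh (m * L) = S at *
    generalize Real.cosh (m * L) = C at *
    generalize tanhHalf L m = t at *
    field_simp
    linear_combination (-(12 : ℝ) * N * m * L + 24 * N * t) * h₂ + 24 * N * h₃
  have : 0 ≤ (12 * m ^ 5 - N * Q) / (12 * m ^ 4) := div_nonneg (by linarith) (by positivity)
  linarith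

/-- The left side of `key_inequality` is positive, so no separate study of the sign of `∫ ψ` is
needed. -/
theorem one_add_mul_psiInt_pos (hL : 0 < L) (hm : 0 < m) (hN : 0 < N)
    (hkey : N ≤ 4 * m ^ 2 / L ^ 3 * sigma (m * L)) : 0 < 1 + N * psiInt L m := by
  refine pos_of_mul_pos_right (lt_of_lt_of_le ?_ (key_inequality hL hm hN hkey)) hm.le
  exact mul_pos (mul_pos hN (sinh_mul_pos hL hm))
    (mul_pos (gDeriv_zero_pos hL hm) (psiDeriv_zero_pos hL hm))

/-- The kernel of the operator `u'''' - m² u'' + N ∫ u`, representing `-u''`. -/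
def kernelFun (L m N : ℝ) (x s : ℝ) : ℝ :=
  greenFun L m x s - N * gFun L m x / (1 + N * psiInt L m) * psiFun L m s

theorem continuous_kernelFun (L m N x : ℝ) : Continuous (kernelFun L m N x) := by
  have h₁ := continuous_greenFun L m x
  have h₂ := continuous_psiFun L m
  unfold kernelFun
  fun_prop

theorem kernelFun_nonneg (hL : 0 < L) (hm : 0 < m) (hN : 0 < N)
    (hkey : N ≤ 4 * m ^ 2 / L ^ 3 * sigma (m * L)) {x s : ℝ} (hx : x ∈ Icc 0 L)
    (hs : s ∈ Icc 0 L) : 0 ≤ kernelFun L m N x s := by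
  have hS := sinh_mul_pos hL hm
  have hE := one_add_mul_psiInt_pos hL hm hN hkey
  have h₁ := gFun_mul_psiFun_le hL hm hx hs
  have h₂ := key_inequality hL hm hN hkey
  have h₃ : 0 ≤ Real.sinh (m * min x s) * Real.sinh (m * (L - max x s)) :=
    mul_nonneg (Real.sinh_nonneg_iff.2 (mul_nonneg hm.le (le_min hx.1 hs.1)))
      (Real.sinh_nonneg_iff.2 (mul_nonneg hm.le (sub_nonneg.2 (max_le hx.2 hs.2))))
  unfold kernelFun greenFun
  generalize Real.sinh (m * min x s) * Real.sinh (m * (L - max x s)) = p at *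
  rw [sub_nonneg, div_mul_eq_mul_div, div_le_div_iff₀ hE (mul_pos hm hS)]
  refine le_of_mul_le_mul_left ?_ hm
  calc m * (N * gFun L m x * psiFun L m s * (m * Real.sinh (m * L)))
      = N * Real.sinh (m * L) * (m ^ 2 * (gFun L m x * psiFun L m s)) := by ring
    _ ≤ N * Real.sinh (m * L) * (gDeriv L m 0 * psiDeriv L m 0 * p) :=
        mul_le_mul_of_nonneg_left h₁ (mul_pos hN hS).le
    _ = N * Real.sinh (m * L) * (gDeriv L m 0 * psiDeriv L m 0) * p := by ring
    _ ≤ m * (1 + N * psiInt L m) * p := mul_le_mul_of_nonneg_right h₂ h₃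
    _ = m * (p * (1 + N * psiInt L m)) := by ring

theorem HasSecondDeriv.eq_integral_greenFun (hL : 0 < L) (hm : 0 < m) {y y₁ y₂ : ℝ → ℝ}
    (hy : HasSecondDeriv L y y₁ y₂) (hy0 : y 0 = 0) (hyL : y L = 0) {x : ℝ} (hx : x ∈ Icc 0 L) :
    y x = ∫ s in (0 : ℝ)..L, greenFun L m x s * (m ^ 2 * y s - y₂ s) := by
  have hq : HasSecondDeriv L (fun x => Real.sinh (m * x)) (fun x => m * Real.cosh (m * x))
      (fun x => m ^ 2 * Real.sinh (m * x)) :=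
    .of_hasDerivAt (hasDerivAt_sinh_mul m)
      (fun x => ((hasDerivAt_cosh_mul m x).const_mul m).congr_deriv (by ring)) (by fun_prop)
  have hlin : ∀ x, HasDerivAt (fun x => m * (L - x)) (-m) x := fun x => by
    simpa using ((hasDerivAt_id x).const_sub L).const_mul m
  have hr : HasSecondDeriv L (fun x => Real.sinh (m * (L - x)))
      (fun x => -m * Real.cosh (m * (L - x))) (fun x => m ^ 2 * Real.sinh (m * (L - x))) :=
    .of_hasDerivAt (fun x => (hlin x).sinh.congr_deriv (by ring))
      (fun x => ((hlin x).cosh.const_mul (-m)).congr_deriv (by ring)) (by fun_prop)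
  refine hy.green_representation hL hy0 hyL hq hr (by simp) (by simp) (by fun_prop) (by fun_prop)
    (mul_pos hm (sinh_mul_pos hL hm)).ne' (fun x => ?_) hx
  have e : m * L = m * x + m * (L - x) := by ring
  rw [e, Real.sinh_add]
  ring

theorem integral_greenFun (hL : 0 < L) (hm : 0 < m) {x : ℝ} (hx : x ∈ Icc 0 L) :
    ∫ s in (0 : ℝ)..L, greenFun L m x s = gFun L m x := by
  rw [(hasSecondDeriv_gFun hm).eq_integral_greenFun hL hm gFun_zero (gFun_right hL hm) hx]
  simp

theorem MemW41.intervalIntegrable_operator (hL : 0 < L) {u : ℝ → ℝ} (hu : MemW41 L u) (M c : ℝ) :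
    IntervalIntegrable (fun s => D L 4 u s - M * D L 2 u s + c) volume 0 L :=
  (((hu.hasSecondDeriv_D hL).intervalIntegrable_deriv₂ hL).sub
    (((hu.hasSecondDeriv_D hL).intervalIntegrable hL).const_mul M)).add intervalIntegrable_const

/-- Lagrange's identity is used twice. The arch `s (L - s) / 2` has second derivative `-1`, so `∫ u`
is minus the integral of `u''` against the arch. The arch is `-ψ'' + m² ψ`, and this operator is
then moved onto `u''`. -/
theorem integral_eq_integral_psiFun (hL : 0 < L) (hm : 0 < m) {u : ℝ → ℝ} (hu : MemW41 L u)
    (hbc : NavierBC L u) :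
    ∫ s in (0 : ℝ)..L, u s
      = ∫ s in (0 : ℝ)..L, psiFun L m s * (D L 4 u s - m ^ 2 * D L 2 u s) := by
  obtain ⟨h0, hLz, h20, h2L⟩ := hbc
  have hu₀ := hasSecondDeriv_of_contDiffOn hL hu.contDiffOn_two
  have hu₂ := hu.hasSecondDeriv_D hL
  have e₁ := hu₀.integral_lagrange (hasSecondDeriv_arch (L := L)) le_rfl hL.le le_rfl
  have e₂ := hu₂.integral_lagrange (hasSecondDeriv_psiFun hm) le_rfl hL.le le_rfl
  simp only [h0, hLz, h20, h2L, psiFun_zero, psiFun_right hL hm] at e₁ e₂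
  have i₁ := hu₀.intervalIntegrable hL
  have i₂ := hu₂.intervalIntegrable hL
  have i₃ : IntervalIntegrable (fun s => D L 2 u s * (s * (L - s) / 2)) volume 0 L :=
    i₂.mul_continuousOn (by fun_prop)
  have i₄ : IntervalIntegrable (fun s => psiFun L m s * (D L 4 u s - m ^ 2 * D L 2 u s))
      volume 0 L :=
    ((hu₂.intervalIntegrable_deriv₂ hL).sub (i₂.const_mul _)).continuousOn_mul
      (continuous_psiFun L m).continuousOn
  have e₃ : ∫ s in (0 : ℝ)..L, (u s * -1 - D L 2 u s * (s * (L - s) / 2))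
      = -(∫ s in (0 : ℝ)..L, u s) - ∫ s in (0 : ℝ)..L, D L 2 u s * (s * (L - s) / 2) := by
    rw [intervalIntegral.integral_sub (i₁.mul_const _) i₃, intervalIntegral.integral_mul_const]
    ring
  have e₄ : ∫ s in (0 : ℝ)..L, (D L 2 u s * (m ^ 2 * psiFun L m s - s * (L - s) / 2)
        - D L 4 u s * psiFun L m s)
      = -(∫ s in (0 : ℝ)..L, psiFun L m s * (D L 4 u s - m ^ 2 * D L 2 u s))
        - ∫ s in (0 : ℝ)..L, D L 2 u s * (s * (L - s) / 2) := by
    rw [neg_eq_neg_one_mul, ← intervalIntegral.integral_const_mul,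
      ← intervalIntegral.integral_sub (i₄.const_mul _) i₃]
    refine intervalIntegral.integral_congr fun s _ => ?_
    ring
  rw [e₃] at e₁
  rw [e₄] at e₂
  linarith

/-- Write `F` for the full operator applied to `u`, and `I = ∫ u`. The function `v = -u''` solves
`-v'' + m² v = F - N I`, so `v = ∫ G F - N I g`. Testing with `ψ` gives `I (1 + N ∫ ψ) = ∫ ψ F`, and
eliminating `I` produces the kernel. -/
theorem neg_D_two_eq_integral_kernelFun (hL : 0 < L) (hm : 0 < m)
    (hE : 0 < 1 + N * psiInt L m) {u : ℝ → ℝ}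
    (hu : MemW41 L u) (hbc : NavierBC L u) {x : ℝ} (hx : x ∈ Icc 0 L) :
    -D L 2 u x = ∫ s in (0 : ℝ)..L, kernelFun L m N x s
      * (D L 4 u s - m ^ 2 * D L 2 u s + N * ∫ t in (0 : ℝ)..L, u t) := by
  have hI := integral_eq_integral_psiFun hL hm hu hbc
  set I := ∫ t in (0 : ℝ)..L, u t
  have hu₂ := hu.hasSecondDeriv_D hL
  have hV := hu₂.eq_integral_greenFun hL hm hbc.2.2.1 hbc.2.2.2 hx
  have iF : IntervalIntegrable (fun s => D L 4 u s - m ^ 2 * D L 2 u s) volume 0 L := by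
    simpa using hu.intervalIntegrable_operator hL (m ^ 2) 0
  have iG := iF.continuousOn_mul (continuous_greenFun L m x).continuousOn
  have iP := iF.continuousOn_mul (continuous_psiFun L m).continuousOn
  have iG' := (continuous_greenFun L m x).intervalIntegrable (μ := volume) 0 L
  have iP' := (continuous_psiFun L m).intervalIntegrable (μ := volume) 0 L
  have e : ∫ s in (0 : ℝ)..L, kernelFun L m N x s * (D L 4 u s - m ^ 2 * D L 2 u s + N * I)
      = ((∫ s in (0 : ℝ)..L, greenFun L m x s * (D L 4 u s - m ^ 2 * D L 2 u s))
          + N * I * gFun L m x)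
        - N * gFun L m x / (1 + N * psiInt L m) * (I + N * I * psiInt L m) := by
    set A := N * I
    set C := N * gFun L m x / (1 + N * psiInt L m)
    have e' : ∀ s, kernelFun L m N x s * (D L 4 u s - m ^ 2 * D L 2 u s + A)
        = (greenFun L m x s * (D L 4 u s - m ^ 2 * D L 2 u s) + A * greenFun L m x s)
          - C * (psiFun L m s * (D L 4 u s - m ^ 2 * D L 2 u s) + A * psiFun L m s) := fun s => by
      change (greenFun L m x s - C * psiFun L m s) * _ = _
      ring
    simp only [e']
    rw [intervalIntegral.integral_sub (iG.add (iG'.const_mul _))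
        ((iP.add (iP'.const_mul _)).const_mul _), intervalIntegral.integral_const_mul,
      intervalIntegral.integral_add iG (iG'.const_mul _),
      intervalIntegral.integral_add iP (iP'.const_mul _), intervalIntegral.integral_const_mul,
      intervalIntegral.integral_const_mul, integral_greenFun hL hm hx, ← hI, psiInt]
  rw [e, hV, ← intervalIntegral.integral_neg]
  have e' : (fun s => -(greenFun L m x s * (m ^ 2 * D L 2 u s - D L 4 u s)))
      = fun s => greenFun L m x s * (D L 4 u s - m ^ 2 * D L 2 u s) := by
    ext s; ring
  rw [e']
  field_simp
  ring

/-- Testing with `ψ` determines what `∫ u` has to be, namely `J`. With this value inserted the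
problem is local, and its solution does have integral `J`. -/
theorem exists_nonlocal_solution (hL : 0 < L) (hm : 0 < m) (hE : 0 < 1 + N * psiInt L m)
    {f : ℝ → ℝ} (hf : IntervalIntegrable f volume 0 L) :
    ∃ u, MemW41 L u ∧ NavierBC L u ∧ ∀ᵐ x ∂(volume.restrict (Ioo 0 L)),
      D L 4 u x - m ^ 2 * D L 2 u x + N * (∫ t in (0 : ℝ)..L, u t) = f x := by
  set J := (∫ s in (0 : ℝ)..L, psiFun L m s * f s) / (1 + N * psiInt L m) with hJ
  obtain ⟨u, hu, hbc, heq⟩ := exists_linear_solution hL hm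
    (h := fun x => f x - N * J) (hf.sub intervalIntegrable_const)
  refine ⟨u, hu, hbc, ?_⟩
  have hI : ∫ t in (0 : ℝ)..L, u t = J := by
    rw [integral_eq_integral_psiFun hL hm hu hbc]
    have e : ∫ s in (0 : ℝ)..L, psiFun L m s * (D L 4 u s - m ^ 2 * D L 2 u s)
        = ∫ s in (0 : ℝ)..L, (psiFun L m s * f s - N * J * psiFun L m s) := by
      refine integral_congr_ae_Ioo le_rfl hL.le le_rfl ?_
      filter_upwards [heq] with x hx
      rw [hx]
      ring
    rw [e, intervalIntegral.integral_sub (hf.continuousOn_mul (continuous_psiFun L m).continuousOn)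
      (((continuous_psiFun L m).intervalIntegrable _ _).const_mul _),
      intervalIntegral.integral_const_mul]
    change _ - N * J * psiInt L m = J
    have : (∫ s in (0 : ℝ)..L, psiFun L m s * f s) = J * (1 + N * psiInt L m) := by
      rw [hJ]; field_simp
    rw [this]
    ring
  filter_upwards [heq] with x hx
  rw [hI, hx]
  ring

end Melan

namespace Melan

/-! ### The order of the sector -/

/-- The order `u ≤ v`, `u'' ≥ v''` on `[0, L]`. -/
def Below (L : ℝ) (u v : ℝ → ℝ) : Prop :=
  ∀ x ∈ Icc 0 L, u x ≤ v x ∧ D L 2 v x ≤ D L 2 u x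

theorem Below.refl (L : ℝ) (u : ℝ → ℝ) : Below L u u := fun _ _ => ⟨le_rfl, le_rfl⟩

theorem Below.eqOn {L : ℝ} {u v : ℝ → ℝ} (h : Below L u v) (h' : Below L v u) :
    EqOn u v (Icc 0 L) := fun x hx => le_antisymm (h x hx).1 (h' x hx).1

/-- With zero boundary values the order of the functions follows from that of the second
derivatives, so only the latter has to be checked. -/
theorem below_of_D_two_le {L : ℝ} (hL : 0 < L) {u v : ℝ → ℝ} (hu : ContDiffOn ℝ 2 u (Icc 0 L))
    (hv : ContDiffOn ℝ 2 v (Icc 0 L)) (hu0 : u 0 = 0) (huL : u L = 0) (hv0 : v 0 = 0)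
    (hvL : v L = 0) (h : ∀ x ∈ Icc 0 L, D L 2 v x ≤ D L 2 u x) : Below L u v := fun x hx => by
  refine ⟨(hasSecondDeriv_of_contDiffOn hL hu).le_of_deriv₂_ge hL
    (hasSecondDeriv_of_contDiffOn hL hv) hu0 huL hv0 hvL ?_ hx, h x hx⟩
  filter_upwards [ae_restrict_mem measurableSet_Ioo] with s hs using h s ⟨hs.1.le, hs.2.le⟩

theorem below_iff_mem_sector {L : ℝ} {u α β : ℝ → ℝ} :
    u ∈ Sector L α β ↔ ContDiffOn ℝ 2 u (Icc 0 L) ∧ Below L α u ∧ Below L u β :=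
  ⟨fun h => ⟨h.1, fun x hx => ⟨(h.2 x hx).1.1, (h.2 x hx).2.1⟩,
    fun x hx => ⟨(h.2 x hx).1.2, (h.2 x hx).2.2⟩⟩,
  fun h => ⟨h.1, fun x hx => ⟨⟨(h.2.1 x hx).1, (h.2.2 x hx).1⟩, (h.2.1 x hx).2, (h.2.2 x hx).2⟩⟩⟩

/-! ### The bounds of the sector -/

theorem D_zero_fun (L : ℝ) (hL : 0 < L) (k : ℕ) {x : ℝ} (hx : x ∈ Icc 0 L) :
    D L k (0 : ℝ → ℝ) x = 0 := by
  have : EqOn (D L k (0 : ℝ → ℝ)) (fun _ => 0) (Icc 0 L) := by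
    induction k with
    | zero => rw [D_zero]; exact fun _ _ => rfl
    | succ k ih => exact D_succ_eqOn hL ih fun x => hasDerivAt_const x 0
  exact this hx

theorem memW41_zero {L : ℝ} (hL : 0 < L) : MemW41 L 0 := by
  refine (memW41_of_hasDerivAt hL (u := 0) (u₁ := fun _ => 0) (u₂ := fun _ => 0)
    (u₃ := fun _ => 0) (u₄ := fun _ => 0) (fun x => hasDerivAt_const x 0)
    (fun x => hasDerivAt_const x 0) (fun x => hasDerivAt_const x 0) continuous_const ?_
    (Eventually.of_forall fun x => hasDerivAt_const x 0)).1
  exact (contDiff_const (c := (0 : ℝ))).contDiffOn.absolutelyContinuousOnInterval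

theorem navierBC_zero {L : ℝ} (hL : 0 < L) : NavierBC L 0 :=
  ⟨rfl, rfl, D_zero_fun L hL 2 ⟨le_rfl, hL.le⟩, D_zero_fun L hL 2 ⟨hL.le, le_rfl⟩⟩

theorem sineArc_spec {L : ℝ} (hL : 0 < L) (lam : ℝ) :
    MemW41 L (sineArc L lam) ∧
      (∀ x ∈ Icc 0 L, D L 2 (sineArc L lam) x
        = -(lam * (Real.pi ^ 2 / L ^ 2) * Real.sin (Real.pi / L * x))) ∧
      ∀ᵐ x ∂(volume.restrict (Ioo 0 L)), D L 4 (sineArc L lam) x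
        = lam * (Real.pi ^ 4 / L ^ 4) * Real.sin (Real.pi / L * x) := by
  set κ := Real.pi / L with hκ
  have hlin : ∀ x, HasDerivAt (fun x => κ * x) κ x := fun x => by
    simpa using (hasDerivAt_id x).const_mul κ
  have hs : ∀ A x, HasDerivAt (fun x => A * Real.sin (κ * x)) (A * κ * Real.cos (κ * x)) x :=
    fun A x => ((hlin x).sin.const_mul A).congr_deriv (by ring)
  have hc : ∀ A x, HasDerivAt (fun x => A * Real.cos (κ * x)) (-(A * κ) * Real.sin (κ * x)) x :=
    fun A x => ((hlin x).cos.const_mul A).congr_deriv (by ring)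
  have h3 := HasSecondDeriv.of_hasDerivAt (L := L) (hc (-(lam * κ * κ) * κ))
    (hs _) (by fun_prop)
  obtain ⟨h₁, h₂, h₄⟩ := memW41_of_hasDerivAt hL (hs lam) (hc _) (hs _) (by fun_prop) h3.absCont
    (Eventually.of_forall (hc _))
  refine ⟨h₁, fun x hx => ?_, ?_⟩
  · refine (h₂ hx).trans ?_
    rw [hκ]
    ring
  · filter_upwards [h₄] with x hx
    refine hx.trans ?_
    rw [hκ]
    ring

theorem sineArc_zero (L lam : ℝ) : sineArc L lam 0 = 0 := by simp [sineArc]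

theorem sineArc_right {L : ℝ} (hL : 0 < L) (lam : ℝ) : sineArc L lam L = 0 := by
  simp [sineArc, div_mul_cancel₀ _ hL.ne']

theorem navierBC_sineArc {L : ℝ} (hL : 0 < L) (lam : ℝ) : NavierBC L (sineArc L lam) := by
  refine ⟨sineArc_zero L lam, sineArc_right hL lam, ?_, ?_⟩
  · rw [(sineArc_spec hL lam).2.1 0 ⟨le_rfl, hL.le⟩]; simp
  · rw [(sineArc_spec hL lam).2.1 L ⟨hL.le, le_rfl⟩]; simp [div_mul_cancel₀ _ hL.ne']

theorem integral_sineArc {L : ℝ} (hL : 0 < L) (lam : ℝ) :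
    ∫ t in (0 : ℝ)..L, sineArc L lam t = 2 * lam * (L / Real.pi) := by
  have hπ := Real.pi_pos
  simp only [sineArc]
  rw [intervalIntegral.integral_const_mul,
    intervalIntegral.integral_comp_mul_left (fun x => Real.sin x) (div_pos hπ hL).ne',
    integral_sin, div_mul_cancel₀ _ hL.ne']
  simp
  ring

theorem sin_nonneg_of_mem {L : ℝ} (hL : 0 < L) {x : ℝ} (hx : x ∈ Icc 0 L) :
    0 ≤ Real.sin (Real.pi / L * x) := by
  have hπ := Real.pi_pos
  refine Real.sin_nonneg_of_nonneg_of_le_pi (mul_nonneg (div_pos hπ hL).le hx.1) ?_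
  calc Real.pi / L * x ≤ Real.pi / L * L := mul_le_mul_of_nonneg_left hx.2 (div_pos hπ hL).le
    _ = Real.pi := div_mul_cancel₀ _ hL.ne'

theorem zero_below_sineArc {L lam : ℝ} (hL : 0 < L) (hlam : 0 < lam) :
    Below L 0 (sineArc L lam) := fun x hx => by
  have hs := sin_nonneg_of_mem hL hx
  rw [D_zero_fun L hL 2 hx, (sineArc_spec hL lam).2.1 x hx]
  exact ⟨mul_nonneg hlam.le hs, neg_nonpos.2 (by positivity)⟩

theorem zero_mem_sector {L lam : ℝ} (hL : 0 < L) (hlam : 0 < lam) :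
    (0 : ℝ → ℝ) ∈ Sector L 0 (sineArc L lam) :=
  below_iff_mem_sector.2 ⟨contDiffOn_const, Below.refl _ _, zero_below_sineArc hL hlam⟩

theorem sineArc_mem_sector {L lam : ℝ} (hL : 0 < L) (hlam : 0 < lam) :
    sineArc L lam ∈ Sector L 0 (sineArc L lam) :=
  below_iff_mem_sector.2
    ⟨(sineArc_spec hL lam).1.contDiffOn_two, zero_below_sineArc hL hlam, Below.refl _ _⟩

section Sector

variable {L lam : ℝ} {u v : ℝ → ℝ}

theorem sector_zero (hL : 0 < L) (hu : u ∈ Sector L 0 (sineArc L lam)) : u 0 = 0 := by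
  have := (hu.2 0 ⟨le_rfl, hL.le⟩).1
  rw [sineArc_zero] at this
  exact le_antisymm this.2 this.1

theorem sector_right (hL : 0 < L) (hu : u ∈ Sector L 0 (sineArc L lam)) : u L = 0 := by
  have := (hu.2 L ⟨hL.le, le_rfl⟩).1
  rw [sineArc_right hL] at this
  exact le_antisymm this.2 this.1

theorem sector_D_two_nonpos (hL : 0 < L) (hu : u ∈ Sector L 0 (sineArc L lam)) {x : ℝ}
    (hx : x ∈ Icc 0 L) : D L 2 u x ≤ 0 :=
  (hu.2 x hx).2.1.trans_eq (D_zero_fun L hL 2 hx)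

theorem sector_le_D_two (hL : 0 < L) (hlam : 0 < lam) (hu : u ∈ Sector L 0 (sineArc L lam))
    {x : ℝ} (hx : x ∈ Icc 0 L) : -(lam * (Real.pi ^ 2 / L ^ 2)) ≤ D L 2 u x := by
  refine le_trans ?_ (hu.2 x hx).2.2
  rw [(sineArc_spec hL lam).2.1 x hx, neg_le_neg_iff]
  exact mul_le_of_le_one_right (by positivity) (Real.sin_le_one _)

theorem sector_intervalIntegrable (hL : 0 < L) (hu : u ∈ Sector L 0 (sineArc L lam)) :
    IntervalIntegrable u volume 0 L :=
  hu.1.continuousOn.intervalIntegrable_of_Icc hL.le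

theorem sector_continuousOn_D_two (hL : 0 < L) (hu : u ∈ Sector L 0 (sineArc L lam)) :
    ContinuousOn (D L 2 u) (Icc 0 L) :=
  continuousOn_D hL (n := 2) (by exact_mod_cast hu.1) le_rfl

theorem Below.integral_le (hL : 0 < L) (h : Below L u v) (hu : IntervalIntegrable u volume 0 L)
    (hv : IntervalIntegrable v volume 0 L) :
    ∫ t in (0 : ℝ)..L, u t ≤ ∫ t in (0 : ℝ)..L, v t :=
  intervalIntegral.integral_mono_on hL.le hu hv fun x hx => (h x hx).1

theorem sector_integral_nonneg (hL : 0 < L) (hu : u ∈ Sector L 0 (sineArc L lam)) :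
    0 ≤ ∫ t in (0 : ℝ)..L, u t :=
  intervalIntegral.integral_nonneg hL.le fun x hx => (hu.2 x hx).1.1

theorem sector_integral_le (hL : 0 < L) (hlam : 0 < lam) (hu : u ∈ Sector L 0 (sineArc L lam)) :
    ∫ t in (0 : ℝ)..L, u t ≤ 2 * lam * (L / Real.pi) := by
  rw [← integral_sineArc hL]
  exact (below_iff_mem_sector.1 hu).2.2.integral_le hL (sector_intervalIntegrable hL hu)
    (sector_intervalIntegrable hL (sineArc_mem_sector hL hlam))

end Sector

/-! ### The iteration -/

/-- The left-hand side of the iteration. -/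
def lhs (L a b c lam : ℝ) (v : ℝ → ℝ) (x : ℝ) : ℝ :=
  D L 4 v x - (a + 2 * b * lam * (L / Real.pi)) * D L 2 v x
    + (c + b * lam * (Real.pi ^ 2 / L ^ 2)) * (∫ t in (0 : ℝ)..L, v t)

/-- The right-hand side of the iteration, as a function of `u''(x)` and `∫ u`. -/
def rhs (L b lam : ℝ) (p : ℝ → ℝ) (d I : ℝ) (x : ℝ) : ℝ :=
  p x + b * d * I - 2 * b * lam * (L / Real.pi) * d + b * lam * (Real.pi ^ 2 / L ^ 2) * I

/-- The standing assumptions. -/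
structure Admissible (L a b c lam : ℝ) (p : ℝ → ℝ) : Prop where
  hL : 0 < L
  ha : 0 < a
  hb : 0 < b
  hc : 0 < c
  hlam : 0 < lam
  hp : IntegrableOn p (Ioo 0 L)
  hp0 : ∀ᵐ x ∂(volume.restrict (Ioo 0 L)), 0 ≤ p x
  hple : ∀ᵐ x ∂(volume.restrict (Ioo 0 L)),
    p x ≤ (lam * (Real.pi ^ 4 / L ^ 4) + a * lam * (Real.pi ^ 2 / L ^ 2)
        + 2 * b * lam ^ 2 * (Real.pi / L)) * Real.sin (Real.pi / L * x)
      + 2 * lam * c * (L / Real.pi)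
  hkey : c + b * lam * (Real.pi ^ 2 / L ^ 2)
    ≤ 4 * (a + 2 * b * lam * (L / Real.pi)) / L ^ 3
      * sigma (Real.sqrt (a + 2 * b * lam * (L / Real.pi)) * L)

/-- The kernel of the left-hand side of the iteration. -/
def stepKernel (L a b c lam : ℝ) : ℝ → ℝ → ℝ :=
  kernelFun L (Real.sqrt (a + 2 * b * lam * (L / Real.pi))) (c + b * lam * (Real.pi ^ 2 / L ^ 2))

theorem continuous_stepKernel (L a b c lam x : ℝ) : Continuous (stepKernel L a b c lam x) :=
  continuous_kernelFun _ _ _ _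

/-! ### Order preservation and invariance of the sector -/

namespace Admissible

variable {L a b c lam : ℝ} {p : ℝ → ℝ}

section
variable (H : Admissible L a b c lam p)
include H

theorem intervalIntegrable_p : IntervalIntegrable p volume 0 L :=
  (intervalIntegrable_iff_integrableOn_Ioo_of_le H.hL.le).2 H.hp

theorem coeff_pos : 0 < a + 2 * b * lam * (L / Real.pi) := by
  have := H.hL; have := H.ha; have := H.hb; have := H.hlam; have := Real.pi_pos
  positivity

theorem coeff_pos' : 0 < c + b * lam * (Real.pi ^ 2 / L ^ 2) := by
  have := H.hL; have := H.hc; have := H.hb; have := H.hlam; have := Real.pi_pos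
  positivity

theorem sq_sqrt_coeff :
    Real.sqrt (a + 2 * b * lam * (L / Real.pi)) ^ 2 = a + 2 * b * lam * (L / Real.pi) :=
  Real.sq_sqrt H.coeff_pos.le

theorem hkey_sqrt : c + b * lam * (Real.pi ^ 2 / L ^ 2)
    ≤ 4 * Real.sqrt (a + 2 * b * lam * (L / Real.pi)) ^ 2 / L ^ 3
      * sigma (Real.sqrt (a + 2 * b * lam * (L / Real.pi)) * L) := by
  rw [H.sq_sqrt_coeff]; exact H.hkey

theorem stepKernel_nonneg {x s : ℝ} (hx : x ∈ Icc 0 L) (hs : s ∈ Icc 0 L) :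
    0 ≤ stepKernel L a b c lam x s :=
  kernelFun_nonneg H.hL (Real.sqrt_pos.2 H.coeff_pos) H.coeff_pos' H.hkey_sqrt hx hs

theorem one_add_pos : 0 < 1 + (c + b * lam * (Real.pi ^ 2 / L ^ 2))
    * psiInt L (Real.sqrt (a + 2 * b * lam * (L / Real.pi))) :=
  one_add_mul_psiInt_pos H.hL (Real.sqrt_pos.2 H.coeff_pos) H.coeff_pos' H.hkey_sqrt

theorem neg_D_two_eq {u : ℝ → ℝ} (hu : MemW41 L u) (hbc : NavierBC L u) {x : ℝ}
    (hx : x ∈ Icc 0 L) :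
    -D L 2 u x = ∫ s in (0 : ℝ)..L, stepKernel L a b c lam x s * lhs L a b c lam u s := by
  rw [neg_D_two_eq_integral_kernelFun H.hL (Real.sqrt_pos.2 H.coeff_pos) H.one_add_pos hu hbc hx]
  simp only [H.sq_sqrt_coeff]
  rfl

theorem exists_lhs_eq {f : ℝ → ℝ} (hf : IntervalIntegrable f volume 0 L) :
    ∃ u, MemW41 L u ∧ NavierBC L u ∧
      ∀ᵐ x ∂(volume.restrict (Ioo 0 L)), lhs L a b c lam u x = f x := by
  obtain ⟨u, h₁, h₂, h₃⟩ :=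
    exists_nonlocal_solution H.hL (Real.sqrt_pos.2 H.coeff_pos) H.one_add_pos hf
  rw [H.sq_sqrt_coeff] at h₃
  exact ⟨u, h₁, h₂, h₃⟩

/-- The comparison principle. -/
theorem below_of_lhs_le {u v : ℝ → ℝ} (hu : MemW41 L u) (hv : MemW41 L v) (hub : NavierBC L u)
    (hvb : NavierBC L v)
    (h : ∀ᵐ x ∂(volume.restrict (Ioo 0 L)), lhs L a b c lam u x ≤ lhs L a b c lam v x) :
    Below L u v := by
  refine below_of_D_two_le H.hL hu.contDiffOn_two hv.contDiffOn_two hub.1 hub.2.1 hvb.1 hvb.2.1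
    fun x hx => ?_
  rw [← neg_le_neg_iff, H.neg_D_two_eq hu hub hx, H.neg_D_two_eq hv hvb hx]
  exact integral_kernel_mono H.hL (continuous_stepKernel _ _ _ _ _ _)
    (fun s hs => H.stepKernel_nonneg hx hs) (hu.intervalIntegrable_operator H.hL _ _)
    (hv.intervalIntegrable_operator H.hL _ _) h

/-- With `K = 2 λ L / π`, `κ = λ π² / L²`, `I = ∫ u` and `J = ∫ v`, the increment is `b [(K - J)(u''
- v'') + (J - I)(u'' + κ)]`. In the sector `J ≤ K` and `u'' ≥ -κ`, which is why the iteration adds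
`b K` and `b κ` to the coefficients. -/
theorem rhs_mono {u v : ℝ → ℝ} (hu : u ∈ Sector L 0 (sineArc L lam))
    (hv : v ∈ Sector L 0 (sineArc L lam)) (h : Below L u v) {x : ℝ} (hx : x ∈ Icc 0 L) :
    rhs L b lam p (D L 2 u x) (∫ t in (0 : ℝ)..L, u t) x
      ≤ rhs L b lam p (D L 2 v x) (∫ t in (0 : ℝ)..L, v t) x := by
  have h₁ := sector_integral_le H.hL H.hlam hv
  have h₂ := h.integral_le H.hL (sector_intervalIntegrable H.hL hu)
    (sector_intervalIntegrable H.hL hv)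
  have h₃ := sector_le_D_two H.hL H.hlam hu hx
  have h₄ := (h x hx).2
  unfold rhs
  generalize (∫ t in (0 : ℝ)..L, u t) = I at *
  generalize (∫ t in (0 : ℝ)..L, v t) = J at *
  have k₁ := mul_nonneg (sub_nonneg.2 h₁) (sub_nonneg.2 h₄)
  have k₂ := mul_nonneg (sub_nonneg.2 h₂) (neg_le_iff_add_nonneg'.1 h₃)
  have k₃ := mul_nonneg H.hb.le (add_nonneg k₁ k₂)
  linarith

theorem rhs_intervalIntegrable {u : ℝ → ℝ} (hu : u ∈ Sector L 0 (sineArc L lam)) (I : ℝ) :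
    IntervalIntegrable (fun x => rhs L b lam p (D L 2 u x) I x) volume 0 L := by
  have hd := (sector_continuousOn_D_two H.hL hu).intervalIntegrable_of_Icc (μ := volume) H.hL.le
  exact (((H.intervalIntegrable_p.add ((hd.const_mul b).mul_const I)).sub
    (hd.const_mul _)).add intervalIntegrable_const)

theorem exists_step {u : ℝ → ℝ} (hu : u ∈ Sector L 0 (sineArc L lam)) :
    ∃ v, IsStep L a b c lam p u v := by
  obtain ⟨v, h₁, h₂, h₃⟩ := H.exists_lhs_eq (H.rhs_intervalIntegrable hu (∫ t in (0 : ℝ)..L, u t))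
  exact ⟨v, h₁, h₂, h₃⟩

theorem step_mono {u v u' v' : ℝ → ℝ} (hu : u ∈ Sector L 0 (sineArc L lam))
    (hv : v ∈ Sector L 0 (sineArc L lam)) (h : Below L u v) (hu' : IsStep L a b c lam p u u')
    (hv' : IsStep L a b c lam p v v') : Below L u' v' := by
  refine H.below_of_lhs_le hu'.mem hv'.mem hu'.bc hv'.bc ?_
  filter_upwards [hu'.eqn, hv'.eqn, ae_restrict_mem measurableSet_Ioo] with x h₁ h₂ hx
  exact h₁.trans_le ((H.rhs_mono hu hv h ⟨hx.1.le, hx.2.le⟩).trans_eq h₂.symm)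

/-- The zero function is a lower solution: its left-hand side is `0` and its right-hand side is `p ≥
0`. -/
theorem zero_below_step {u u' : ℝ → ℝ} (hu : u ∈ Sector L 0 (sineArc L lam))
    (hu' : IsStep L a b c lam p u u') : Below L 0 u' := by
  refine H.below_of_lhs_le (memW41_zero H.hL) hu'.mem (navierBC_zero H.hL) hu'.bc ?_
  filter_upwards [hu'.eqn, H.hp0, ae_restrict_mem measurableSet_Ioo] with x h₁ h₂ hx
  have hx' : x ∈ Icc 0 L := ⟨hx.1.le, hx.2.le⟩
  have h₃ := H.rhs_mono (zero_mem_sector H.hL H.hlam) hu (below_iff_mem_sector.1 hu).2.1 hx'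
  refine le_trans ?_ (h₃.trans_eq h₁.symm)
  simpa [lhs, rhs, D_zero_fun L H.hL _ hx'] using h₂

/-- The sine arc is an upper solution: that its left-hand side dominates its right-hand side is
exactly the assumed upper bound on `p`. -/
theorem step_below_sineArc {u u' : ℝ → ℝ} (hu : u ∈ Sector L 0 (sineArc L lam))
    (hu' : IsStep L a b c lam p u u') : Below L u' (sineArc L lam) := by
  have hspec := sineArc_spec H.hL lam
  refine H.below_of_lhs_le hu'.mem hspec.1 hu'.bc (navierBC_sineArc H.hL lam) ?_
  filter_upwards [hu'.eqn, H.hple, hspec.2.2, ae_restrict_mem measurableSet_Ioo] with x h₁ h₂ h₄ hx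
  have hx' : x ∈ Icc 0 L := ⟨hx.1.le, hx.2.le⟩
  have h₃ := H.rhs_mono hu (sineArc_mem_sector H.hL H.hlam) (below_iff_mem_sector.1 hu).2.2 hx'
  refine (h₁.trans_le h₃).trans ?_
  have hL := H.hL
  have hπ := Real.pi_pos
  have e : b * (lam * (Real.pi ^ 2 / L ^ 2)) * (2 * lam * (L / Real.pi))
      = 2 * b * lam ^ 2 * (Real.pi / L) := by
    field_simp
  simp only [lhs, rhs, h₄, hspec.2.1 x hx', integral_sineArc hL]
  generalize Real.sin (Real.pi / L * x) = S at *
  linear_combination h₂ - S * e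

theorem step_mem_sector {u u' : ℝ → ℝ} (hu : u ∈ Sector L 0 (sineArc L lam))
    (hu' : IsStep L a b c lam p u u') : u' ∈ Sector L 0 (sineArc L lam) :=
  below_iff_mem_sector.2
    ⟨hu'.mem.contDiffOn_two, H.zero_below_step hu hu', H.step_below_sineArc hu hu'⟩

theorem iteration_mem_sector {u₀ : ℝ → ℝ} {u : ℕ → ℝ → ℝ} (hu₀ : u₀ ∈ Sector L 0 (sineArc L lam))
    (hu : IsIteration L a b c lam p u₀ u) (n : ℕ) : u n ∈ Sector L 0 (sineArc L lam) := by
  induction n with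
  | zero => rwa [hu.init]
  | succ n ih => exact H.step_mem_sector ih (hu.step n)

theorem iteration_mono {u₀ v₀ : ℝ → ℝ} {u v : ℕ → ℝ → ℝ}
    (hu₀ : u₀ ∈ Sector L 0 (sineArc L lam)) (hv₀ : v₀ ∈ Sector L 0 (sineArc L lam))
    (hu : IsIteration L a b c lam p u₀ u) (hv : IsIteration L a b c lam p v₀ v)
    (h : Below L u₀ v₀) (n : ℕ) : Below L (u n) (v n) := by
  induction n with
  | zero => rwa [hu.init, hv.init]
  | succ n ih =>
    exact H.step_mono (H.iteration_mem_sector hu₀ hu n) (H.iteration_mem_sector hv₀ hv n) ih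
      (hu.step n) (hv.step n)

theorem exists_iteration {u₀ : ℝ → ℝ} (hu₀ : u₀ ∈ Sector L 0 (sineArc L lam)) :
    ∃ u, IsIteration L a b c lam p u₀ u := by
  -- Invariance of the sector makes one step a self-map of the sector, which can then be iterated.
  choose F hF using fun u : Sector L 0 (sineArc L lam) => H.exists_step u.2
  let G : Sector L 0 (sineArc L lam) → Sector L 0 (sineArc L lam) :=
    fun u => ⟨F u, H.step_mem_sector u.2 (hF u)⟩
  exact ⟨fun n => (G^[n] ⟨u₀, hu₀⟩ : Sector L 0 (sineArc L lam)), rfl, fun n => by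
    rw [Function.iterate_succ_apply']
    exact hF _⟩

end

end Admissible

end Melan

namespace Melan

/-! ### Solutions and limits of the iteration -/

/-- At a fixed point the terms added to both sides cancel, whatever `lam` is. -/
theorem isStep_self_iff {L a b c lam : ℝ} {p w : ℝ → ℝ} :
    IsStep L a b c lam p w w ↔ IsSolution L a b c p w := by
  constructor
  · rintro ⟨h₁, h₂, h₃⟩
    refine ⟨h₁, h₂, ?_⟩
    filter_upwards [h₃] with x hx
    linear_combination hx
  · rintro ⟨h₁, h₂, h₃⟩
    refine ⟨h₁, h₂, ?_⟩
    filter_upwards [h₃] with x hx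
    linear_combination hx

/-- This lets `iteration_mono` compare solutions with iterates. -/
theorem isIteration_const {L a b c lam : ℝ} {p w : ℝ → ℝ} (h : IsSolution L a b c p w) :
    IsIteration L a b c lam p w (fun _ => w) :=
  ⟨rfl, fun _ => isStep_self_iff.2 h⟩

/-- Expresses `∫ u` through `u''` alone, so that convergence of second derivatives controls the
nonlocal term. -/
theorem integral_eq_integral_arch {L : ℝ} (hL : 0 < L) {u : ℝ → ℝ}
    (hu : ContDiffOn ℝ 2 u (Icc 0 L)) (h0 : u 0 = 0) (hLz : u L = 0) :
    ∫ s in (0 : ℝ)..L, u s = -∫ s in (0 : ℝ)..L, (s * (L - s) / 2) * D L 2 u s := by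
  have hu₀ := hasSecondDeriv_of_contDiffOn hL hu
  have e := hu₀.integral_lagrange (hasSecondDeriv_arch (L := L)) le_rfl hL.le le_rfl
  have i := (hu₀.intervalIntegrable_deriv₂ hL).mul_continuousOn
    (g := fun s => s * (L - s) / 2) (by fun_prop)
  rw [intervalIntegral.integral_sub ((hu₀.intervalIntegrable hL).mul_const _) i,
    intervalIntegral.integral_mul_const] at e
  simp only [h0, hLz] at e
  simp only [mul_comm (_ / 2 : ℝ)]
  linarith

/-- Dominated convergence against a continuous kernel. -/
theorem tendsto_integral_kernel {L : ℝ} (hL : 0 < L) {k bound f : ℝ → ℝ} {F : ℕ → ℝ → ℝ}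
    (hk : Continuous k) (hF : ∀ n, IntervalIntegrable (F n) volume 0 L)
    (hbi : IntervalIntegrable bound volume 0 L) (hb : ∀ n, ∀ x ∈ Icc 0 L, |F n x| ≤ bound x)
    (hlim : ∀ x ∈ Icc 0 L, Tendsto (fun n => F n x) atTop (𝓝 (f x))) :
    Tendsto (fun n => ∫ s in (0 : ℝ)..L, k s * F n s) atTop (𝓝 (∫ s in (0 : ℝ)..L, k s * f s)) := by
  have hsub : ∀ x, x ∈ uIoc 0 L → x ∈ Icc 0 L := fun x hx => by
    rw [uIoc_of_le hL.le] at hx; exact ⟨hx.1.le, hx.2⟩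
  refine intervalIntegral.tendsto_integral_filter_of_dominated_convergence
    (fun x => |k x| * bound x) (Eventually.of_forall fun n => ?_)
    (Eventually.of_forall fun n => Eventually.of_forall fun x hx => ?_)
    (hbi.continuousOn_mul (by fun_prop)) (Eventually.of_forall fun x hx => ?_)
  · exact ((hF n).continuousOn_mul hk.continuousOn).def'.aestronglyMeasurable
  · rw [Real.norm_eq_abs, abs_mul]
    exact mul_le_mul_of_nonneg_left (hb n x (hsub x hx)) (abs_nonneg _)
  · exact (hlim x (hsub x hx)).const_mul _

theorem intervalIntegrable_of_tendsto {L C : ℝ} (hL : 0 < L) {f : ℝ → ℝ} {F : ℕ → ℝ → ℝ}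
    (hF : ∀ n, IntervalIntegrable (F n) volume 0 L) (hb : ∀ n, ∀ x ∈ Icc 0 L, |F n x| ≤ C)
    (hlim : ∀ x ∈ Icc 0 L, Tendsto (fun n => F n x) atTop (𝓝 (f x))) :
    IntervalIntegrable f volume 0 L := by
  have hF' := fun n => (intervalIntegrable_iff_integrableOn_Ioo_of_le hL.le).1 (hF n)
  rw [intervalIntegrable_iff_integrableOn_Ioo_of_le hL.le]
  have hlim' : ∀ᵐ x ∂(volume.restrict (Ioo 0 L)), Tendsto (fun n => F n x) atTop (𝓝 (f x)) := by
    filter_upwards [ae_restrict_mem measurableSet_Ioo] with x hx using hlim x ⟨hx.1.le, hx.2.le⟩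
  have hm : AEStronglyMeasurable f (volume.restrict (Ioo 0 L)) :=
    aestronglyMeasurable_of_tendsto_ae atTop (fun n => (hF' n).aestronglyMeasurable) hlim'
  refine Integrable.mono' (g := fun _ => C) (integrable_const C) hm ?_
  filter_upwards [ae_restrict_mem measurableSet_Ioo] with x hx
  have hx' : x ∈ Icc 0 L := ⟨hx.1.le, hx.2.le⟩
  exact le_of_tendsto (hlim x hx').abs (Eventually.of_forall fun n => hb n x hx')

theorem sector_abs_D_two_le {L lam : ℝ} (hL : 0 < L) (hlam : 0 < lam) {u : ℝ → ℝ}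
    (hu : u ∈ Sector L 0 (sineArc L lam)) {x : ℝ} (hx : x ∈ Icc 0 L) :
    |D L 2 u x| ≤ lam * (Real.pi ^ 2 / L ^ 2) :=
  abs_le.2 ⟨sector_le_D_two hL hlam hu hx,
    (sector_D_two_nonpos hL hu hx).trans (by positivity)⟩

theorem sector_D_two_intervalIntegrable {L lam : ℝ} (hL : 0 < L) {u : ℝ → ℝ}
    (hu : u ∈ Sector L 0 (sineArc L lam)) : IntervalIntegrable (D L 2 u) volume 0 L :=
  (sector_continuousOn_D_two hL hu).intervalIntegrable_of_Icc hL.le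

theorem sector_tendsto_integral {L lam : ℝ} (hL : 0 < L) (hlam : 0 < lam) {k W : ℝ → ℝ}
    {u : ℕ → ℝ → ℝ} (hk : Continuous k) (hu : ∀ n, u n ∈ Sector L 0 (sineArc L lam))
    (hlim : ∀ x ∈ Icc 0 L, Tendsto (fun n => D L 2 (u n) x) atTop (𝓝 (W x))) :
    Tendsto (fun n => ∫ s in (0 : ℝ)..L, k s * D L 2 (u n) s) atTop
      (𝓝 (∫ s in (0 : ℝ)..L, k s * W s)) :=
  tendsto_integral_kernel hL hk (fun n => sector_D_two_intervalIntegrable hL (hu n))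
    (bound := fun _ => lam * (Real.pi ^ 2 / L ^ 2)) intervalIntegrable_const
    (fun n _ hx => sector_abs_D_two_le hL hlam (hu n) hx) hlim

/-- The order fixes the sign of `u'' - v''`, so its integral is its `L¹` norm, and the Dirichlet
kernel is at most `L`. The bound is uniform in `x`; this is where uniform convergence comes from. -/
theorem sub_le_integral {L lam : ℝ} (hL : 0 < L) {u v : ℝ → ℝ} (hu : u ∈ Sector L 0 (sineArc L lam))
    (hv : v ∈ Sector L 0 (sineArc L lam)) (h : Below L u v) {x : ℝ} (hx : x ∈ Icc 0 L) :
    v x - u x ≤ L * ((∫ s in (0 : ℝ)..L, D L 2 u s) - ∫ s in (0 : ℝ)..L, D L 2 v s) := by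
  have iu := sector_D_two_intervalIntegrable hL hu
  have iv := sector_D_two_intervalIntegrable hL hv
  have hc : Continuous fun s => min x s * (L - max x s) / L := by fun_prop
  have ju : IntervalIntegrable (fun s => min x s * (L - max x s) / L * -D L 2 u s) volume 0 L :=
    iu.neg.continuousOn_mul hc.continuousOn
  have jv : IntervalIntegrable (fun s => min x s * (L - max x s) / L * -D L 2 v s) volume 0 L :=
    iv.neg.continuousOn_mul hc.continuousOn
  rw [(hasSecondDeriv_of_contDiffOn hL hu.1).eq_integral_dirichlet hL (sector_zero hL hu)
    (sector_right hL hu) hx, (hasSecondDeriv_of_contDiffOn hL hv.1).eq_integral_dirichlet hL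
    (sector_zero hL hv) (sector_right hL hv) hx,
    ← intervalIntegral.integral_sub jv ju,
    ← intervalIntegral.integral_sub iu iv, ← intervalIntegral.integral_const_mul]
  refine intervalIntegral.integral_mono_on hL.le
    (jv.sub ju)
    ((iu.sub iv).const_mul L) fun s hs => ?_
  have h₁ := dirichlet_kernel_le hL hx hs
  have h₂ := sub_nonneg.2 (h s hs).2
  have := mul_le_mul_of_nonneg_right h₁ h₂
  linarith

/-! ### Passage to the limit, uniqueness and positivity -/

namespace Admissible

variable {L a b c lam : ℝ} {p : ℝ → ℝ}

section
variable (H : Admissible L a b c lam p)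
include H

/-- An iteration whose second derivatives converge pointwise converges to a solution. -/
theorem exists_limit_solution {u₀ : ℝ → ℝ} {u : ℕ → ℝ → ℝ} {W : ℝ → ℝ}
    (hu₀ : u₀ ∈ Sector L 0 (sineArc L lam)) (hu : IsIteration L a b c lam p u₀ u)
    (hW : ∀ x ∈ Icc 0 L, Tendsto (fun n => D L 2 (u n) x) atTop (𝓝 (W x))) :
    ∃ y, IsSolution L a b c p y ∧ y ∈ Sector L 0 (sineArc L lam) ∧
      ∀ x ∈ Icc 0 L, D L 2 y x = W x := by
  have hL := H.hL
  have hmem := H.iteration_mem_sector hu₀ hu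
  set κ := lam * (Real.pi ^ 2 / L ^ 2) with hκ
  set K := 2 * lam * (L / Real.pi) with hK
  set I := -∫ s in (0 : ℝ)..L, (s * (L - s) / 2) * W s with hI
  have hIn : Tendsto (fun n => ∫ s in (0 : ℝ)..L, u n s) atTop (𝓝 I) := by
    have := (sector_tendsto_integral hL H.hlam (k := fun s => s * (L - s) / 2) (by fun_prop)
      hmem hW).neg
    refine this.congr fun n => ?_
    rw [integral_eq_integral_arch hL (hmem n).1 (sector_zero hL (hmem n))
      (sector_right hL (hmem n))]
  have hWi : IntervalIntegrable W volume 0 L :=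
    intervalIntegrable_of_tendsto hL (fun n => sector_D_two_intervalIntegrable hL (hmem n))
      (fun n _ hx => sector_abs_D_two_le hL H.hlam (hmem n) hx) hW
  have hfi : IntervalIntegrable (fun x => rhs L b lam p (W x) I x) volume 0 L :=
    ((H.intervalIntegrable_p.add ((hWi.const_mul b).mul_const I)).sub
      (hWi.const_mul _)).add intervalIntegrable_const
  -- The candidate solves the linear problem whose right-hand side is the limit one. This gives
  -- `W^{4,1}` regularity at once; it remains to identify `y''` with `W`.
  obtain ⟨y, hy, hbc, heq⟩ := H.exists_lhs_eq (c := c) (a := a) hfi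
  have hyW : ∀ x ∈ Icc 0 L, D L 2 y x = W x := fun x hx => by
    have t₁ : Tendsto (fun n => ∫ s in (0 : ℝ)..L, stepKernel L a b c lam x s
        * rhs L b lam p (D L 2 (u n) s) (∫ t in (0 : ℝ)..L, u n t) s) atTop
        (𝓝 (∫ s in (0 : ℝ)..L, stepKernel L a b c lam x s * rhs L b lam p (W s) I s)) := by
      refine tendsto_integral_kernel hL (continuous_stepKernel _ _ _ _ _ _)
        (fun n => H.rhs_intervalIntegrable (hmem n) _)
        (bound := fun s => |p s| + (b * (κ * K) + b * (K * κ) + b * (κ * K)))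
        (H.intervalIntegrable_p.abs.add intervalIntegrable_const)
        (fun n s hs => ?_) (fun s hs => ?_)
      · have h₁ := sector_abs_D_two_le hL H.hlam (hmem n) hs
        have h₂ : |∫ t in (0 : ℝ)..L, u n t| ≤ K := by
          rw [abs_of_nonneg (sector_integral_nonneg hL (hmem n))]
          exact sector_integral_le hL H.hlam (hmem n)
        have hb := H.hb
        have hκ0 : 0 ≤ κ := (abs_nonneg _).trans h₁
        have hK0 : 0 ≤ K := (abs_nonneg _).trans h₂
        generalize (∫ t in (0 : ℝ)..L, u n t) = J at *
        generalize D L 2 (u n) s = d at *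
        have e : rhs L b lam p d J s = p s + (b * (d * J) - b * (K * d) + b * (κ * J)) := by
          rw [rhs, hκ, hK]; ring
        have a₁ : |d * J| ≤ κ * K := by
          rw [abs_mul]; exact mul_le_mul h₁ h₂ (abs_nonneg _) hκ0
        have a₂ : |K * d| ≤ K * κ := by
          rw [abs_mul, abs_of_nonneg hK0]; exact mul_le_mul_of_nonneg_left h₁ hK0
        have a₃ : |κ * J| ≤ κ * K := by
          rw [abs_mul, abs_of_nonneg hκ0]; exact mul_le_mul_of_nonneg_left h₂ hκ0
        rw [e]
        refine (abs_add_le _ _).trans (add_le_add le_rfl ?_)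
        have hmul : ∀ {r R : ℝ}, |r| ≤ R → |b * r| ≤ b * R := fun {r R} h => by
          rw [abs_mul, abs_of_pos hb]; exact mul_le_mul_of_nonneg_left h hb.le
        exact (abs_add_le _ _).trans (add_le_add ((abs_sub _ _).trans
          (add_le_add (hmul a₁) (hmul a₂))) (hmul a₃))
      · have hd := hW s hs
        exact ((tendsto_const_nhds.add ((hd.const_mul b).mul hIn)).sub (hd.const_mul _)).add
          (hIn.const_mul _)
    have t₂ : Tendsto (fun n => -D L 2 (u (n + 1)) x) atTop (𝓝 (-D L 2 y x)) := by
      have ey : -D L 2 y x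
          = ∫ s in (0 : ℝ)..L, stepKernel L a b c lam x s * rhs L b lam p (W s) I s := by
        rw [H.neg_D_two_eq hy hbc hx]
        refine integral_congr_ae_Ioo le_rfl hL.le le_rfl ?_
        filter_upwards [heq] with s hs
        rw [hs]
      rw [ey]
      refine t₁.congr fun n => ?_
      rw [H.neg_D_two_eq (hu.step n).mem (hu.step n).bc hx]
      refine integral_congr_ae_Ioo le_rfl hL.le le_rfl ?_
      filter_upwards [(hu.step n).eqn] with s hs
      rw [lhs, hs, rhs]
    -- The kernel formula expresses the second derivative of `u (n + 1)` through `u n`, and the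
    -- shifted sequence still tends to `W`.
    exact neg_injective (tendsto_nhds_unique t₂ ((hW x hx).comp (tendsto_add_atTop_nat 1)).neg)
  have hIy : ∫ t in (0 : ℝ)..L, y t = I := by
    rw [integral_eq_integral_arch hL hy.contDiffOn_two hbc.1 hbc.2.1, hI]
    congr 1
    refine intervalIntegral.integral_congr fun s hs => ?_
    rw [uIcc_of_le hL.le] at hs
    simp only [hyW s hs]
  refine ⟨y, (isStep_self_iff (lam := lam)).1 ⟨hy, hbc, ?_⟩, below_iff_mem_sector.2
    ⟨hy.contDiffOn_two, ?_, ?_⟩, hyW⟩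
  · filter_upwards [heq, ae_restrict_mem measurableSet_Ioo] with x hx hm
    rw [← hyW x ⟨hm.1.le, hm.2.le⟩, ← hIy] at hx
    exact hx
  · refine below_of_D_two_le hL contDiffOn_const hy.contDiffOn_two rfl rfl hbc.1 hbc.2.1
      fun x hx => ?_
    rw [hyW x hx]
    exact le_of_tendsto (hW x hx) (Eventually.of_forall fun n => ((hmem n).2 x hx).2.1)
  · refine below_of_D_two_le hL hy.contDiffOn_two (sineArc_mem_sector hL H.hlam).1 hbc.1 hbc.2.1
      (sineArc_zero _ _) (sineArc_right hL _) fun x hx => ?_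
    rw [hyW x hx]
    exact ge_of_tendsto (hW x hx) (Eventually.of_forall fun n => ((hmem n).2 x hx).2.2)

/-- Two comparable solutions in the sector coincide. This needs no smallness of `lam`. -/
theorem below_symm_of_isSolution {y z : ℝ → ℝ} (hy : IsSolution L a b c p y)
    (hz : IsSolution L a b c p z) (hys : y ∈ Sector L 0 (sineArc L lam))
    (hzs : z ∈ Sector L 0 (sineArc L lam)) (h : Below L y z) : Below L z y := by
  have hL := H.hL
  refine below_of_D_two_le hL hz.mem.contDiffOn_two hy.mem.contDiffOn_two hz.bc.1 hz.bc.2.1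
    hy.bc.1 hy.bc.2.1 fun x hx => ?_
  -- The maximum principle is applied to `y''` and `z''`. With `I = ∫ y` and `J = ∫ z`, the
  -- equations give `y'''' - z'''' = (a + b J)(y'' - z'') + b (J - I)(-y'') + c (J - I)`, a sum of
  -- nonnegative terms.
  refine (hy.mem.hasSecondDeriv_D hL).le_of_deriv₂_ge hL (hz.mem.hasSecondDeriv_D hL)
    hy.bc.2.2.1 hy.bc.2.2.2 hz.bc.2.2.1 hz.bc.2.2.2 ?_ hx
  have hI := h.integral_le hL (sector_intervalIntegrable hL hys) (sector_intervalIntegrable hL hzs)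
  have hI0 := sector_integral_nonneg hL hzs
  filter_upwards [hy.eqn, hz.eqn, ae_restrict_mem measurableSet_Ioo] with s h₁ h₂ hs
  have hs' : s ∈ Icc 0 L := ⟨hs.1.le, hs.2.le⟩
  have h₃ := (h s hs').2
  have h₄ := sector_D_two_nonpos hL hys hs'
  generalize (∫ t in (0 : ℝ)..L, y t) = I at *
  generalize (∫ t in (0 : ℝ)..L, z t) = J at *
  have k₁ : 0 ≤ (a + b * J) * (D L 2 y s - D L 2 z s) :=
    mul_nonneg (add_nonneg H.ha.le (mul_nonneg H.hb.le hI0)) (sub_nonneg.2 h₃)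
  have k₂ : 0 ≤ b * (J - I) * (-D L 2 y s) :=
    mul_nonneg (mul_nonneg H.hb.le (sub_nonneg.2 hI)) (neg_nonneg.2 h₄)
  have k₃ : 0 ≤ c * (J - I) := mul_nonneg H.hc.le (sub_nonneg.2 hI)
  linarith

theorem exists_limit_from_zero {u : ℕ → ℝ → ℝ} (hu : IsIteration L a b c lam p 0 u) :
    ∃ y, IsSolution L a b c p y ∧ y ∈ Sector L 0 (sineArc L lam) ∧
      ∀ x ∈ Icc 0 L, Tendsto (fun n => D L 2 (u n) x) atTop (𝓝 (D L 2 y x)) := by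
  have h0 := zero_mem_sector H.hL H.hlam
  have hmem := H.iteration_mem_sector h0 hu
  -- The tail `u (n + 1)` is the iteration started at `u 1`, which lies above `0`. Comparing it with
  -- `u` itself gives monotonicity in `n`.
  have hmono := H.iteration_mono h0 (hmem 1) hu (v := fun n => u (n + 1))
    ⟨rfl, fun n => hu.step (n + 1)⟩ (below_iff_mem_sector.1 (hmem 1)).2.1
  have hlim : ∀ x ∈ Icc 0 L, Tendsto (fun n => D L 2 (u n) x) atTop (𝓝 (⨅ n, D L 2 (u n) x)) :=
    fun x hx => tendsto_atTop_ciInf (antitone_nat_of_succ_le fun n => (hmono n x hx).2)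
      ⟨_, by rintro _ ⟨n, rfl⟩; exact sector_le_D_two H.hL H.hlam (hmem n) hx⟩
  obtain ⟨y, h₁, h₂, h₃⟩ := H.exists_limit_solution h0 hu hlim
  exact ⟨y, h₁, h₂, fun x hx => (h₃ x hx).symm ▸ hlim x hx⟩

theorem exists_limit_from_sineArc {u : ℕ → ℝ → ℝ}
    (hu : IsIteration L a b c lam p (sineArc L lam) u) :
    ∃ y, IsSolution L a b c p y ∧ y ∈ Sector L 0 (sineArc L lam) ∧
      ∀ x ∈ Icc 0 L, Tendsto (fun n => D L 2 (u n) x) atTop (𝓝 (D L 2 y x)) := by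
  have h0 := sineArc_mem_sector H.hL H.hlam
  have hmem := H.iteration_mem_sector h0 hu
  have hmono := H.iteration_mono (hmem 1) h0 (u := fun n => u (n + 1))
    ⟨rfl, fun n => hu.step (n + 1)⟩ hu (below_iff_mem_sector.1 (hmem 1)).2.2
  have hlim : ∀ x ∈ Icc 0 L, Tendsto (fun n => D L 2 (u n) x) atTop (𝓝 (⨆ n, D L 2 (u n) x)) :=
    fun x hx => tendsto_atTop_ciSup (monotone_nat_of_le_succ fun n => (hmono n x hx).2)
      ⟨0, by rintro _ ⟨n, rfl⟩; exact sector_D_two_nonpos H.hL (hmem n) hx⟩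
  obtain ⟨y, h₁, h₂, h₃⟩ := H.exists_limit_solution h0 hu hlim
  exact ⟨y, h₁, h₂, fun x hx => (h₃ x hx).symm ▸ hlim x hx⟩

/-- A solution in the sector is positive in `(0, L)` unless `p` vanishes. -/
theorem solution_pos (hpne : ¬ p =ᵐ[volume.restrict (Ioo 0 L)] 0) {y : ℝ → ℝ}
    (hy : IsSolution L a b c p y) (hys : y ∈ Sector L 0 (sineArc L lam)) {x : ℝ}
    (hx : x ∈ Ioo 0 L) : 0 < y x := by
  have hL := H.hL
  have hx' : x ∈ Icc 0 L := ⟨hx.1.le, hx.2.le⟩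
  have hrep : ∀ x ∈ Icc 0 L, _ := fun x hx =>
    (hasSecondDeriv_of_contDiffOn hL hys.1).eq_integral_dirichlet hL hy.bc.1 hy.bc.2.1 hx
  -- If `y''` is negative somewhere, the boundary conditions make that point interior, where the
  -- Dirichlet kernel is positive. Otherwise `y` vanishes identically and the equation forces `p =
  -- 0` almost everywhere.
  by_cases hV : ∃ s ∈ Icc 0 L, D L 2 y s < 0
  · obtain ⟨s, hs, hneg⟩ := hV
    have hs0 : s ≠ 0 := by rintro rfl; exact hneg.ne hy.bc.2.2.1
    have hsL : s ≠ L := by rintro rfl; exact hneg.ne hy.bc.2.2.2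
    rw [hrep x hx']
    refine intervalIntegral.integral_pos hL
      (ContinuousOn.mul (by fun_prop) (sector_continuousOn_D_two hL hys).neg) (fun t ht => ?_)
      ⟨s, hs, ?_⟩
    · exact mul_nonneg (dirichlet_kernel_nonneg hx' ⟨ht.1.le, ht.2⟩)
        (neg_nonneg.2 (sector_D_two_nonpos hL hys ⟨ht.1.le, ht.2⟩))
    · refine mul_pos (div_pos (mul_pos (lt_min hx.1 (lt_of_le_of_ne hs.1 hs0.symm)) ?_) hL)
        (neg_pos.2 hneg)
      exact sub_pos.2 (max_lt hx.2 (lt_of_le_of_ne hs.2 hsL))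
  · exfalso
    push Not at hV
    have hV0 : ∀ s ∈ Icc 0 L, D L 2 y s = 0 := fun s hs =>
      le_antisymm (sector_D_two_nonpos hL hys hs) (hV s hs)
    have hy0 : EqOn y 0 (Icc 0 L) := fun x hx => by
      rw [hrep x hx, intervalIntegral.integral_congr (g := fun _ => 0) fun s hs => ?_]
      · simp
      · rw [uIcc_of_le hL.le] at hs
        simp [hV0 s hs]
    have hI : ∫ t in (0 : ℝ)..L, y t = 0 := by
      rw [intervalIntegral.integral_congr (g := fun _ => 0) fun s hs => ?_]
      · simp
      · rw [uIcc_of_le hL.le] at hs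
        exact hy0 hs
    refine hpne ?_
    filter_upwards [hy.eqn, ae_restrict_mem measurableSet_Ioo] with s hs hm
    have hm' : s ∈ Icc 0 L := ⟨hm.1.le, hm.2.le⟩
    rw [hI, D_congr hy0 4 hm', D_congr hy0 2 hm', D_zero_fun L hL 4 hm',
      D_zero_fun L hL 2 hm'] at hs
    simpa using hs.symm

/-- The iterations started from the two bounds of the sector enclose a unique solution. -/
theorem exists_solution :
    ∃ y, IsSolution L a b c p y ∧ y ∈ Sector L 0 (sineArc L lam) ∧
      (∀ w, IsSolution L a b c p w → w ∈ Sector L 0 (sineArc L lam) → EqOn w y (Icc 0 L)) ∧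
      ∀ u₀ ∈ Sector L 0 (sineArc L lam), IterationConverges L a b c lam p u₀ y := by
  have hL := H.hL
  have hzero := zero_mem_sector hL H.hlam
  have harc := sineArc_mem_sector hL H.hlam
  obtain ⟨α, hα⟩ := H.exists_iteration hzero
  obtain ⟨β, hβ⟩ := H.exists_iteration harc
  have hαs := H.iteration_mem_sector hzero hα
  have hβs := H.iteration_mem_sector harc hβ
  have hαβ := H.iteration_mono hzero harc hα hβ (zero_below_sineArc hL H.hlam)
  obtain ⟨y, hy, hys, hylim⟩ := H.exists_limit_from_zero hα
  obtain ⟨z, hz, hzs, hzlim⟩ := H.exists_limit_from_sineArc hβ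
  -- A solution in the sector is a constant iteration starting above `0`, so it stays above every `α
  -- n` and hence above `y`.
  have hleast : ∀ w, IsSolution L a b c p w → w ∈ Sector L 0 (sineArc L lam) →
      Below L y w := fun w hw hws =>
    below_of_D_two_le hL hys.1 hws.1 hy.bc.1 hy.bc.2.1 hw.bc.1 hw.bc.2.1 fun x hx =>
      ge_of_tendsto (hylim x hx) (Eventually.of_forall fun n =>
        (H.iteration_mono hzero hws hα (isIteration_const hw)
          (below_iff_mem_sector.1 hws).2.1 n x hx).2)
  have hyz : ∀ x ∈ Icc 0 L, D L 2 z x = D L 2 y x := fun x hx =>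
    le_antisymm (hleast z hz hzs x hx).2
      (H.below_symm_of_isSolution hy hz hys hzs (hleast z hz hzs) x hx).2
  -- Bound for the width of the bracket between `α n` and `β n`. It tends to `0` because both
  -- sequences of second derivatives have the same limit.
  set ε : ℕ → ℝ := fun n =>
    L * ((∫ s in (0 : ℝ)..L, D L 2 (α n) s) - ∫ s in (0 : ℝ)..L, D L 2 (β n) s) with hε
  have hεlim : Tendsto ε atTop (𝓝 0) := by
    have h₁ := sector_tendsto_integral hL H.hlam (k := fun _ => 1) continuous_const hαs hylim
    have h₂ := sector_tendsto_integral hL H.hlam (k := fun _ => 1) continuous_const hβs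
      (fun x hx => hyz x hx ▸ hzlim x hx)
    simpa [hε] using (h₁.sub h₂).const_mul L
  refine ⟨y, hy, hys, fun w hw hws => Below.eqOn
    (H.below_symm_of_isSolution hy hw hys hws (hleast w hw hws)) (hleast w hw hws),
    fun u₀ hu₀ => ⟨H.exists_iteration hu₀, fun u v hu hv n => ?_, fun u hu => ?_⟩⟩
  · exact Below.eqOn (H.iteration_mono hu₀ hu₀ hu hv (Below.refl _ _) n)
      (H.iteration_mono hu₀ hu₀ hv hu (Below.refl _ _) n)
  -- Both `u n` and `y` lie between `α n` and `β n`, so their distance is at most `ε n`.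
  · have hb := below_iff_mem_sector.1 hu₀
    have hby := below_iff_mem_sector.1 hys
    have h₁ := H.iteration_mono hzero hu₀ hα hu hb.2.1
    have h₂ := H.iteration_mono hu₀ harc hu hβ hb.2.2
    have h₃ := H.iteration_mono hzero hys hα (isIteration_const hy) hby.2.1
    have h₄ := H.iteration_mono hys harc (isIteration_const hy) hβ hby.2.2
    rw [Metric.tendstoUniformlyOn_iff]
    intro δ hδ
    filter_upwards [hεlim.eventually_lt_const hδ] with n hn x hx
    have h₅ := sub_le_integral hL (hαs n) (hβs n) (hαβ n) hx
    rw [Real.dist_eq]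
    refine lt_of_le_of_lt (abs_le.2 ⟨?_, ?_⟩) (h₅.trans_lt hn)
    · linarith [(h₂ n x hx).1, (h₃ n x hx).1]
    · linarith [(h₁ n x hx).1, (h₄ n x hx).1]

end

end Admissible

end Melan

end

theorem theorem5p2 (L a b c lam : ℝ) (p : ℝ → ℝ)
    (hL : 0 < L) (ha : 0 < a) (hb : 0 < b) (hc : 0 < c) (hlam : 0 < lam)
    (hp : IntegrableOn p (Ioo 0 L))
    (hp0 : ∀ᵐ x ∂(volume.restrict (Ioo 0 L)), 0 ≤ p x)
    (hple : ∀ᵐ x ∂(volume.restrict (Ioo 0 L)),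
      p x ≤ (lam * (Real.pi ^ 4 / L ^ 4) + a * lam * (Real.pi ^ 2 / L ^ 2)
          + 2 * b * lam ^ 2 * (Real.pi / L)) * Real.sin (Real.pi / L * x)
        + 2 * lam * c * (L / Real.pi))
    (hkey : c + b * lam * (Real.pi ^ 2 / L ^ 2)
      ≤ 4 * (a + 2 * b * lam * (L / Real.pi)) / L ^ 3
        * Melan.sigma (Real.sqrt (a + 2 * b * lam * (L / Real.pi)) * L))
    (hpne : ¬ p =ᵐ[volume.restrict (Ioo 0 L)] 0)
    (huniq : lam * (L ^ 3 / 4) * (2 * b / Real.pi + b * Real.pi ^ 2 / 4) ≤ 1) :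
    ∃ y : ℝ → ℝ,
      -- `y` is a positive solution in the sector
      (Melan.IsSolution L a b c p y ∧ y ∈ Melan.Sector L 0 (Melan.sineArc L lam) ∧
        ∀ x ∈ Ioo 0 L, 0 < y x) ∧
      -- it is the only solution in the sector
      (∀ w, Melan.IsSolution L a b c p w → w ∈ Melan.Sector L 0 (Melan.sineArc L lam) →
        EqOn w y (Icc 0 L)) ∧
      -- convergence of the iterations
      Melan.IterationConverges L a b c lam p 0 y ∧
      Melan.IterationConverges L a b c lam p (Melan.sineArc L lam) y ∧
      ∀ u₀ ∈ Melan.Sector L 0 (Melan.sineArc L lam),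
        Melan.IterationConverges L a b c lam p u₀ y := by
  have H : Melan.Admissible L a b c lam p := ⟨hL, ha, hb, hc, hlam, hp, hp0, hple, hkey⟩
  obtain ⟨y, hy, hys, huniq', hconv⟩ := H.exists_solution
  exact ⟨y, ⟨hy, hys, fun x hx => H.solution_pos hpne hy hys hx⟩, huniq',
    hconv _ (Melan.zero_mem_sector hL hlam), hconv _ (Melan.sineArc_mem_sector hL hlam), hconv⟩
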